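/- Let $a\in\mathbb R$ and $\sigma,\varepsilon\in\{1,-1\}$. On $\mathbb R^4$ with coordinates $(t,x,y,z)$ let $\Omega_a$ be the complement of $\{z=0,\ x^2+y^2\le a^2\}$ and let $r=\varepsilon r_a$, where $r_a>0$ is the positive solution on $\Omega_a$ of $r^2(x^2+y^2+z^2)+a^2z^2=r^2(r^2+a^2)$. Put $\eta=-dt^2+dx^2+dy^2+dz^2$ and $$\ell=\ell_{(\sigma)}=\frac1{\sqrt2}\Big(\sigma\,dt+\frac zr\,dz+\frac{rx+ay}{r^2+a^2}\,dx+\frac{ry-ax}{r^2+a^2}\,dy\Big).$$ The Kerr–Newman metric with parameters $M,Q,a\in\mathbb R$, written in the Kerr–Schild coordinates adapted to its principal null direction $\ell$, is $g_{KN}=\eta+2H\,\ell\otimes\ell$ with $H=\dfrac{2Mr-Q^2}{r^2+a^2(z/r)^2}$; the two signs $\sigma$ correspond to the two principal null directions. Let $U\subseteq\Omega_a$ be open and connected. A smooth vector field $\xi$ on $U$ is a Kerr–Schild vector field of $(U,g,\ell)$, for a metric $g$ with respect to which $\ell$ is null, with smooth gauges $h,m:U\to\mathbb R$, if $\mathcal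 L_\xi g=2h\,\ell\otimes\ell$ and $\mathcal L_\xi\ell=m\,\ell$ on $U$; it is called proper if $h\neq0$. A Kerr–Schild motion is a map obtained by flowing points inside $U$ along a Kerr–Schild vector field of $U$ for a fixed time. Then for $g=g_{KN}$, with arbitrary $M,Q$: 1. There are no proper Kerr–Schild vector fields; indeed $h=m=0$ on $U$ for every Kerr–Schild vector field. 2. If $a\ne0$, the Kerr–Schild vector fields are exactly the restrictions to $U$ of the real linear combinations of $\partial_t$ and $x\partial_y-y\partial_x$. The Kerr–Schild motions are given by the group $T_t\otimes T_\varphi$ of time translations and rotations about the $z$-axis: every Kerr–Schild motion defined on a subset of $U$ is the restriction of an element of this group and, if the group maps $U$ into itself, every element of the group is a Kerr–Schild motion of all of $U$. 3. If $a=0$, the Kerr–Schild vector fields are exactly the restrictions to $U$ of the real linear combinations of $\partial_t$, $x\partial_y-y\partial_x$, $x\partial_z-z\partial_x$, $y\partial_z-z\partial_y$, and the Kerr–Schild motions are given, in the same sense, by the group $T_t\otimes SO(3)$ of time translations and spatial rotations. The same conclusions (1, and 2 or 3 according to $a$) hold for every metric $g=\eta+2H\,\ell\otimes\ell$ with $H$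 smooth on $U$ and of the form $H=H(r,z/r)$ if $a\neq0$, respectively $H=H(r)$ if $a=0$; in particular they hold for the flat metric $\eta$. -/

import Mathlib

open scoped ContDiff Matrix

namespace KerrSchild

noncomputable section

/-! ### Kerr-Schild vector fields and motions in a coordinate domain of a four-dimensional spacetime -/

/-- Coordinates `(t, x, y, z) = (p 0, p 1, p 2, p 3)`. -/
abbrev Coord := Fin 4 → ℝ

/-- The partial derivative `∂f / ∂x^k`. -/
def pd (k : Fin 4) (f : Coord → ℝ) (p : Coord) : ℝ := fderiv ℝ f p (Pi.single k 1)

/-- Components of the Lie derivative of a 2-covariant tensor field: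
`(L_ξ g)_ij = ξ^k ∂_k g_ij + g_kj ∂_i ξ^k + g_ik ∂_j ξ^k`. -/
def lieMetric (ξ : Coord → Coord) (g : Coord → Matrix (Fin 4) (Fin 4) ℝ) (p : Coord) :
    Matrix (Fin 4) (Fin 4) ℝ :=
  Matrix.of fun i j => ∑ k, (ξ p k * pd k (fun q => g q i j) p
    + g p k j * pd i (fun q => ξ q k) p + g p i k * pd j (fun q => ξ q k) p)

/-- Components of the Lie derivative of a 1-form: `(L_ξ ℓ)_i = ξ^k ∂_k ℓ_i + ℓ_k ∂_i ξ^k`. -/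
def lieForm (ξ : Coord → Coord) (l : Coord → (Fin 4 → ℝ)) (p : Coord) : Fin 4 → ℝ :=
  fun i => ∑ k, (ξ p k * pd k (fun q => l q i) p + l p k * pd i (fun q => ξ q k) p)

/-- A nonzero covector `l` is null for the (nondegenerate) metric `g` if the vector `v`
obtained from `l` by raising the index satisfies `l v = 0`. -/
def IsNullCovector (g : Matrix (Fin 4) (Fin 4) ℝ) (l : Fin 4 → ℝ) : Prop :=
  l ≠ 0 ∧ ∃ v : Fin 4 → ℝ, g *ᵥ v = l ∧ l ⬝ᵥ v = 0

/-- `ξ` is a Kerr-Schild vector field on the open set `U`, for the metric `g` and the null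
1-form `l`, with gauges `h` and `m`: `L_ξ g = 2 h l ⊗ l` and `L_ξ l = m l`. -/
structure IsKSVF (U : Set Coord) (g : Coord → Matrix (Fin 4) (Fin 4) ℝ)
    (l : Coord → (Fin 4 → ℝ)) (ξ : Coord → Coord) (h m : Coord → ℝ) : Prop where
  null : ∀ p ∈ U, IsNullCovector (g p) (l p)
  smooth_field : ContDiffOn ℝ ∞ ξ U
  smooth_h : ContDiffOn ℝ ∞ h U
  smooth_m : ContDiffOn ℝ ∞ m U
  lie_metric : ∀ p ∈ U, lieMetric ξ g p = (2 * h p) • Matrix.vecMulVec (l p) (l p)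
  lie_form : ∀ p ∈ U, lieForm ξ l p = m p • l p

/-- `Ψ` is, on `V`, a (local) Kerr-Schild motion of `U`: it flows the points of `V` inside `U`
along a Kerr-Schild vector field of `U`. The flow time is normalized to `1`, since constant
multiples of Kerr-Schild vector fields are again Kerr-Schild vector fields. -/
def IsKSMotion (U : Set Coord) (g : Coord → Matrix (Fin 4) (Fin 4) ℝ)
    (l : Coord → (Fin 4 → ℝ)) (V : Set Coord) (Ψ : Coord → Coord) : Prop :=
  ∃ (ξ : Coord → Coord) (h m : Coord → ℝ), IsKSVF U g l ξ h m ∧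
    ∀ p ∈ V, ∃ γ : ℝ → Coord, γ 0 = p ∧ γ 1 = Ψ p ∧
      ∀ s ∈ Set.Icc (0 : ℝ) 1, γ s ∈ U ∧
        HasDerivWithinAt γ (ξ (γ s)) (Set.Icc (0 : ℝ) 1) s

/-- The solution of the Kerr-Schild problem for `(U, g, l)`: no proper Kerr-Schild vector fields,
the Kerr-Schild vector fields are the restrictions to `U` of the elements of the Lie algebra `L`
of vector fields, and the Kerr-Schild motions are given by the transformation group `G`. -/
structure KSSolution (U : Set Coord) (g : Coord → Matrix (Fin 4) (Fin 4) ℝ)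
    (l : Coord → (Fin 4 → ℝ)) (L : Submodule ℝ (Coord → Coord)) (G : Set (Coord → Coord)) :
    Prop where
  no_proper : ∀ (ξ : Coord → Coord) (h m : Coord → ℝ), IsKSVF U g l ξ h m →
    ∀ p ∈ U, h p = 0 ∧ m p = 0
  ksvf_iff : ∀ ξ : Coord → Coord,
    (∃ h m : Coord → ℝ, IsKSVF U g l ξ h m) ↔ ∃ X ∈ L, Set.EqOn ξ X U
  /-- Every local Kerr-Schild motion is the restriction of an element of `G`. -/
  motion_mem : ∀ (V : Set Coord) (Ψ : Coord → Coord), V ⊆ U → IsKSMotion U g l V Ψ →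
    ∃ Φ ∈ G, Set.EqOn Ψ Φ V
  /-- If `G` acts on `U`, then each of its elements is a Kerr-Schild motion of the whole of `U`. -/
  motion_of_mem : (∀ Φ ∈ G, Set.MapsTo Φ U U) → ∀ Φ ∈ G, IsKSMotion U g l U Φ

/-! ### Kerr-Schild metrics with the Kerr-Newman principal null directions -/

/-- The nonnegative solution `r` of `r²(x² + y² + z²) + a² z² = r²(r² + a²)` that is positive
outside the disc `z = 0`, `x² + y² ≤ a²`. -/
def radius (a : ℝ) (p : Coord) : ℝ :=
  √((p 1 ^ 2 + p 2 ^ 2 + p 3 ^ 2 - a ^ 2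
    + √((p 1 ^ 2 + p 2 ^ 2 + p 3 ^ 2 - a ^ 2) ^ 2 + 4 * a ^ 2 * p 3 ^ 2)) / 2)

/-- The complement of the world tube of the disc `z = 0`, `x² + y² ≤ a²`
(of the world line `x = y = z = 0` if `a = 0`). -/
def domain (a : ℝ) : Set Coord := {p | ¬ (p 3 = 0 ∧ p 1 ^ 2 + p 2 ^ 2 ≤ a ^ 2)}

/-- The two nonvanishing branches `r = ± radius` of the solution on the domain. -/
def branch (ε : ℤˣ) (a : ℝ) (p : Coord) : ℝ := ((ε : ℤ) : ℝ) * radius a p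

theorem radius_eq (a : ℝ) (p : Coord) :
    radius a p ^ 2 * (p 1 ^ 2 + p 2 ^ 2 + p 3 ^ 2) + a ^ 2 * p 3 ^ 2
      = radius a p ^ 2 * (radius a p ^ 2 + a ^ 2) := by
  have h1 : (0 : ℝ) ≤ (p 1 ^ 2 + p 2 ^ 2 + p 3 ^ 2 - a ^ 2) ^ 2 + 4 * a ^ 2 * p 3 ^ 2 := by
    positivity
  have h2 : |p 1 ^ 2 + p 2 ^ 2 + p 3 ^ 2 - a ^ 2|
      ≤ √((p 1 ^ 2 + p 2 ^ 2 + p 3 ^ 2 - a ^ 2) ^ 2 + 4 * a ^ 2 * p 3 ^ 2) :=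
    Real.abs_le_sqrt (by nlinarith [sq_nonneg (a * p 3)])
  have h3 := neg_abs_le (p 1 ^ 2 + p 2 ^ 2 + p 3 ^ 2 - a ^ 2)
  have h4 : radius a p ^ 2 = (p 1 ^ 2 + p 2 ^ 2 + p 3 ^ 2 - a ^ 2
    + √((p 1 ^ 2 + p 2 ^ 2 + p 3 ^ 2 - a ^ 2) ^ 2 + 4 * a ^ 2 * p 3 ^ 2)) / 2 :=
    Real.sq_sqrt (by linarith)
  have h5 := Real.sq_sqrt h1
  rw [h4]
  nlinarith

theorem radius_pos {a : ℝ} {p : Coord} (hp : p ∈ domain a) : 0 < radius a p := by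
  refine lt_of_le_of_ne (Real.sqrt_nonneg _) fun h0 => hp ?_
  have h1 := radius_eq a p
  rw [← h0] at h1
  have h2 : a * p 3 = 0 := by nlinarith
  have h3 := Real.sqrt_eq_zero'.1 h0.symm
  rw [show 4 * a ^ 2 * p 3 ^ 2 = 4 * (a * p 3) ^ 2 by ring, h2] at h3
  simp only [ne_eq, OfNat.ofNat_ne_zero, not_false_eq_true, zero_pow, mul_zero, add_zero,
    Real.sqrt_sq_eq_abs] at h3
  have h4 := neg_abs_le (p 1 ^ 2 + p 2 ^ 2 + p 3 ^ 2 - a ^ 2)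
  have h5 := abs_nonneg (p 1 ^ 2 + p 2 ^ 2 + p 3 ^ 2 - a ^ 2)
  have h6 : p 1 ^ 2 + p 2 ^ 2 + p 3 ^ 2 ≤ a ^ 2 := by linarith
  rcases mul_eq_zero.1 h2 with h | h
  · subst h
    have : p 3 = 0 := by nlinarith [sq_nonneg (p 1), sq_nonneg (p 2), sq_nonneg (p 3)]
    exact ⟨this, by nlinarith [sq_nonneg (p 3)]⟩
  · exact ⟨h, by nlinarith [sq_nonneg (p 3)]⟩

/-- The null directions
`ℓ = (σ dt + (z/r) dz + (r x + a y)/(r² + a²) dx + (r y - a x)/(r² + a²) dy) / √2`, `σ = ±1`. -/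
def pnd (σ ε : ℤˣ) (a : ℝ) (p : Coord) : Fin 4 → ℝ :=
  (1 / √2) • ![((σ : ℤ) : ℝ),
    (branch ε a p * p 1 + a * p 2) / (branch ε a p ^ 2 + a ^ 2),
    (branch ε a p * p 2 - a * p 1) / (branch ε a p ^ 2 + a ^ 2),
    p 3 / branch ε a p]

/-- The flat metric `η = diag(-1, 1, 1, 1)`. -/
def eta : Matrix (Fin 4) (Fin 4) ℝ := Matrix.diagonal ![-1, 1, 1, 1]

/-- The Kerr-Schild metric `η + 2 H l ⊗ l`. -/
def ksMetric (H : Coord → ℝ) (l : Coord → (Fin 4 → ℝ)) (p : Coord) :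
    Matrix (Fin 4) (Fin 4) ℝ :=
  eta + (2 * H p) • Matrix.vecMulVec (l p) (l p)

/-- The Kerr-Newman function `H = (2 M r - Q²) / (r² + a² (z/r)²)`. -/
def knH (ε : ℤˣ) (M Q a : ℝ) (p : Coord) : ℝ :=
  (2 * M * branch ε a p - Q ^ 2) / (branch ε a p ^ 2 + a ^ 2 * (p 3 / branch ε a p) ^ 2)

/-! ### The Lie algebras and groups of motions -/

/-- `∂_t`. -/
def fieldT : Coord → Coord := fun _ => ![1, 0, 0, 0]

/-- `x ∂_y - y ∂_x`. -/
def rotXY : Coord → Coord := fun p => ![0, -p 2, p 1, 0]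

/-- `x ∂_z - z ∂_x`. -/
def rotXZ : Coord → Coord := fun p => ![0, -p 3, 0, p 1]

/-- `y ∂_z - z ∂_y`. -/
def rotYZ : Coord → Coord := fun p => ![0, 0, -p 3, p 2]

/-- The span of `∂_t` and `x ∂_y - y ∂_x`. -/
def axialAlgebra : Submodule ℝ (Coord → Coord) := Submodule.span ℝ {fieldT, rotXY}

/-- The span of `∂_t` and the three rotation fields. -/
def sphericalAlgebra : Submodule ℝ (Coord → Coord) :=
  Submodule.span ℝ {fieldT, rotXY, rotXZ, rotYZ}

/-- `T_t ⊗ T_φ`: time translations and rotations around the `z`-axis. -/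
def axialGroup : Set (Coord → Coord) :=
  {Φ | ∃ c θ : ℝ, Φ = fun p => ![p 0 + c, Real.cos θ * p 1 - Real.sin θ * p 2,
    Real.sin θ * p 1 + Real.cos θ * p 2, p 3]}

/-- `T_t ⊗ SO(3)`: time translations and spatial rotations. -/
def sphericalGroup : Set (Coord → Coord) :=
  {Φ | ∃ (c : ℝ) (R : Matrix (Fin 3) (Fin 3) ℝ), R ∈ Matrix.specialOrthogonalGroup (Fin 3) ℝ ∧
    Φ = fun p => Fin.cons (p 0 + c) (R *ᵥ ![p 1, p 2, p 3])}

end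

end KerrSchild

/-! ### Adapted frames and the flat equations in them -/

namespace KerrSchild

/-! The function `H` hardly matters. If `L_ξ ℓ = m ℓ`, the Lie derivative of `2 H ℓ ⊗ ℓ` is again a
multiple of `ℓ ⊗ ℓ`, so `ξ` is a Kerr-Schild field of `g` exactly when it is one of `η`, with
another gauge `h` (`isKSVF_iff`). What remains is a problem about a congruence of straight null
lines. With direction `n` on the unit sphere and affine parameter `r`, space is `x = r n + a e₃ ×
n`, and `√2 ℓ = du + a (n₀-n₁ twist form n 1 dn 0 - n 0 dn 1)` for `u = σ t + r`.

Put `N = ξ n`, `R = ξ r`, `B = ξ u`, and let `k` be the ray vector. The equations give `[ξ, k] = m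
k`, so `N`, `B` and `m` are constant along the rays and `k R = -m`. Differentiating the other
equations along `k` separates powers of `r`: `N` does not depend on time, `m` is constant, and `N`
is a homothety of the sphere of directions with factor `m`. The integrability conditions on the
sphere force `m = 0` (`Solution.m_eq_zero`). Hence `R = 0`, the flat gauge vanishes, and `N = b × n`
with `b` constant. The twist enters only through the integrability of the equation for `B`, which
yields `a b 0 = a b 1 = 0`: the axis is vertical if `a ≠ 0` and free if `a = 0`
(`Solution.exists_axis`). So `ξ` is a time translation plus a rotation about an admissible axis. `H`
is invariant under these, so the original `h` vanishes too; conversely all such fields are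
solutions.

The motions are the flows of these fields, given explicitly by Rodrigues' formula. Euler's rotation
theorem (`exists_rodrigues`) shows that they exhaust `SO(3)`.

The computation is carried out in a commutative `ℝ`-algebra with derivations, so each step is a
linear combination of identities. The three redundant fields `Y i`, with `∑ n i Y i = 0`, replace a
chart of the sphere. The derivatives of `n` and `r` are read off from `x = r n + a e₃ × n`, never
from the nested square roots. -/

theorem forall_fin_three {p : Fin 3 → Prop} : (∀ i, p i) ↔ p 0 ∧ p 1 ∧ p 2 := by
  constructor
  · exact fun h => ⟨h 0, h 1, h 2⟩
  · rintro ⟨h0, h1, h2⟩ i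
    fin_cases i <;> assumption

/-- A frame of derivations adapted to a null congruence with direction field `n`, parametrized by
`r` along the rays: `k` is tangent to the rays, `Z` is the time translation and the `Y i` are lifts
of the tangential gradients of the sphere of directions. -/
structure AdaptedFrame (A : Type*) [CommRing A] [Algebra ℝ A] where
  α : A
  n : Fin 3 → A
  r : A
  k : Derivation ℝ A A
  Z : Derivation ℝ A A
  Y : Fin 3 → Derivation ℝ A A
  c : Fin 3 → Fin 3 → A
  norm_n : n 0 ^ 2 + n 1 ^ 2 + n 2 ^ 2 = 1
  k_α : k α = 0
  Z_α : Z α = 0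
  Y_α : ∀ i, Y i α = 0
  k_n : ∀ i, k (n i) = 0
  Z_n : ∀ i, Z (n i) = 0
  Y_n : ∀ i j, Y i (n j) = (if i = j then 1 else 0) - n i * n j
  k_r : k r = 1
  Z_r : Z r = 0
  Y_r : ∀ i, Y i r = 0
  k_Z : ∀ f, k (Z f) = Z (k f)
  k_Y : ∀ i f, k (Y i f) = Y i (k f)
  Z_Y : ∀ i f, Z (Y i f) = Y i (Z f)
  Y_Y : ∀ i j f, Y i (Y j f) - Y j (Y i f) = n i * Y j f - n j * Y i f + c i j * Z f
  n_Y : ∀ f, n 0 * Y 0 f + n 1 * Y 1 f + n 2 * Y 2 f = 0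

namespace AdaptedFrame

variable {A : Type*} [CommRing A] [Algebra ℝ A] (F : AdaptedFrame A)

/-- The tangential projector of the sphere of directions. -/
def P (i j : Fin 3) : A := (if i = j then 1 else 0) - F.n i * F.n j

/-- The components of the twist form. -/
def twist : Fin 3 → A := ![F.n 1, -F.n 0, 0]

/-- The components, with respect to an adapted frame, of the equations of flat Kerr-Schild vector
fields `ξ`, in terms of `N = ξ n`, `R = ξ r` and `B = ξ u`, where `Z u = 1` and `k u = 0`. -/
structure Solution (N : Fin 3 → A) (R B m h : A) : Prop where
  n_N : F.n 0 * N 0 + F.n 1 * N 1 + F.n 2 * N 2 = 0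
  k_N : ∀ i, F.k (N i) = 0
  k_R : F.k R = -m
  k_B : F.k B = 0
  form_Z : F.Z B + F.α * (F.n 1 * F.Z (N 0) - F.n 0 * F.Z (N 1)) = m
  form_Y : ∀ i, F.Y i B + F.α * (N 1 * F.P i 0 - N 0 * F.P i 1
    + (F.n 1 * F.Y i (N 0) - F.n 0 * F.Y i (N 1))) = 0
  metric_ZZ : 2 * (F.Z R - F.Z B) = h
  metric_ZY : ∀ i, -(F.Y i B - F.α * F.twist i * F.Z B) + F.Y i R
    + F.r ^ 2 * (F.P i 0 * F.Z (N 0) + F.P i 1 * F.Z (N 1) + F.P i 2 * F.Z (N 2))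
    + F.α ^ 2 * (F.P i 0 * F.Z (N 0) + F.P i 1 * F.Z (N 1)) = 0
  metric_YY : ∀ i j, F.α * (F.twist i * F.Y j B + F.twist j * F.Y i B) + 2 * R * F.r * F.P i j
    + F.r ^ 2 * (F.P i 0 * F.Y j (N 0) + F.P i 1 * F.Y j (N 1) + F.P i 2 * F.Y j (N 2)
      + (F.P j 0 * F.Y i (N 0) + F.P j 1 * F.Y i (N 1) + F.P j 2 * F.Y i (N 2)))
    + F.α ^ 2 * (F.P i 0 * F.Y j (N 0) + F.P i 1 * F.Y j (N 1)
      + (F.P j 0 * F.Y i (N 0) + F.P j 1 * F.Y i (N 1))) = 0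

/-- The complex structure of the sphere of directions. -/
def J : Fin 3 → Fin 3 → A :=
  ![![0, F.n 2, -F.n 1], ![-F.n 2, 0, F.n 0], ![F.n 1, -F.n 0, 0]]

variable {F}

theorem Y_P (i j l : Fin 3) : F.Y i (F.P j l) = -(F.P i j * F.n l) - F.n j * F.P i l := by
  have h0 : F.Y i (if j = l then 1 else 0) = 0 := by split_ifs <;> simp
  simp only [P, map_sub, Derivation.leibniz, F.Y_n, smul_eq_mul, h0]
  ring

variable (F) in
theorem P_comm (i j : Fin 3) : F.P i j = F.P j i := by
  simp only [P, eq_comm (a := i), mul_comm]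

theorem Y_J (i j l : Fin 3) : F.Y i (F.J j l) =
    ![![0, F.P i 2, -F.P i 1], ![-F.P i 2, 0, F.P i 0], ![F.P i 1, -F.P i 0, 0]] j l := by
  fin_cases j <;> fin_cases l <;> simp [J, P, F.Y_n]

theorem k_P (i j : Fin 3) : F.k (F.P i j) = 0 := by
  simp only [P]; split_ifs <;> simp [F.k_n]

theorem k_twist (i : Fin 3) : F.k (F.twist i) = 0 := by
  fin_cases i <;> simp [twist, F.k_n]

theorem derivation_two (D : Derivation ℝ A A) : D 2 = 0 := by
  exact_mod_cast D.map_natCast 2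

/-- `A` will be a ring of smooth functions, which has zero divisors; cancelling the scalar 2 is
still legitimate over `ℝ`. -/
theorem eq_zero_of_two_mul {x : A} (hx : 2 * x = 0) : x = 0 := by
  have h : (algebraMap ℝ A (1 / 2)) * 2 = 1 := by
    rw [← map_ofNat (algebraMap ℝ A) 2, ← map_mul]; norm_num
  linear_combination (-x) * h + (algebraMap ℝ A (1 / 2)) * hx

/-! ### Solving the flat equations -/

namespace Solution

variable {N : Fin 3 → A} {R B m h : A} (S : F.Solution N R B m h)
include S

theorem k_m : F.k m = 0 := by
  rw [← S.form_Z]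
  simp [F.k_Z, S.k_B, F.k_α, F.k_n, S.k_N]

theorem Z_N_tangent : F.n 0 * F.Z (N 0) + F.n 1 * F.Z (N 1) + F.n 2 * F.Z (N 2) = 0 := by
  have := congrArg F.Z S.n_N
  simp [F.Z_n] at this
  linear_combination this

theorem Y_N_tangent (i : Fin 3) :
    F.n 0 * F.Y i (N 0) + F.n 1 * F.Y i (N 1) + F.n 2 * F.Y i (N 2) + N i = 0 := by
  have := congrArg (F.Y i) S.n_N
  simp only [map_add, Derivation.leibniz, F.Y_n, smul_eq_mul, map_zero] at this
  have h2 := S.n_N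
  revert i
  simp only [forall_fin_three]
  refine ⟨fun h => ?_, fun h => ?_, fun h => ?_⟩ <;> simp at h
  · linear_combination h + F.n 0 * h2
  · linear_combination h + F.n 1 * h2
  · linear_combination h + F.n 2 * h2

theorem P_Z_N (i : Fin 3) :
    F.P i 0 * F.Z (N 0) + F.P i 1 * F.Z (N 1) + F.P i 2 * F.Z (N 2) = F.Z (N i) := by
  have h2 := S.Z_N_tangent
  revert i
  simp only [forall_fin_three]
  refine ⟨?_, ?_, ?_⟩ <;> simp [P]
  · linear_combination -F.n 0 * h2
  · linear_combination -F.n 1 * h2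
  · linear_combination -F.n 2 * h2

theorem P_Y_N (i j : Fin 3) :
    F.P i 0 * F.Y j (N 0) + F.P i 1 * F.Y j (N 1) + F.P i 2 * F.Y j (N 2)
      = F.Y j (N i) + F.n i * N j := by
  have h2 := S.Y_N_tangent j
  revert i
  simp only [forall_fin_three]
  refine ⟨?_, ?_, ?_⟩ <;> simp [P]
  · linear_combination -F.n 0 * h2
  · linear_combination -F.n 1 * h2
  · linear_combination -F.n 2 * h2

/-- This is the `k`-derivative of the mixed component `metric_ZY`: the terms in `B` and `α ^ 2` are
constant along rays, and `k R = -m`. A second `k`-derivative also removes `Y i m`, which separates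
the two summands. -/
theorem two_r_Z_N (i : Fin 3) : -F.Y i m + 2 * F.r * F.Z (N i) = 0 := by
  have := congrArg F.k (S.metric_ZY i)
  rw [S.P_Z_N] at this
  simp [F.k_Z, F.k_Y, S.k_B, F.k_α, S.k_N, k_P, k_twist, S.k_R, F.k_r] at this
  linear_combination this

theorem Z_N (i : Fin 3) : F.Z (N i) = 0 := by
  have := congrArg F.k (S.two_r_Z_N i)
  simp [derivation_two, F.k_Z, F.k_Y, S.k_N, F.k_r, S.k_m] at this
  exact eq_zero_of_two_mul (by linear_combination this)

theorem Y_m (i : Fin 3) : F.Y i m = 0 := by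
  linear_combination -S.two_r_Z_N i + 2 * F.r * S.Z_N i

theorem Z_B : F.Z B = m := by
  simpa [S.Z_N] using S.form_Z

theorem metric_YY_deriv (i j : Fin 3) : 2 * (R - m * F.r) * F.P i j
    + 2 * F.r * (F.Y j (N i) + F.n i * N j + (F.Y i (N j) + F.n j * N i)) = 0 := by
  have := congrArg F.k (S.metric_YY i j)
  rw [S.P_Y_N, S.P_Y_N] at this
  simp [derivation_two, F.k_Y, S.k_B, F.k_α, S.k_N, k_P, k_twist, S.k_R, F.k_r, F.k_n] at this
  linear_combination this

/-- The second `k`-derivative of `metric_YY`. The twist terms are constant along rays and disappear,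
and what is left says that `N`, as a tangent field of the sphere, satisfies `L_N P = 2 m P`. -/
theorem homothety (i j : Fin 3) :
    F.Y j (N i) + F.n i * N j + (F.Y i (N j) + F.n j * N i) = 2 * m * F.P i j := by
  have := congrArg F.k (S.metric_YY_deriv i j)
  simp [derivation_two, F.k_Y, S.k_N, k_P, S.k_R, F.k_r, F.k_n, S.k_m] at this
  rw [← sub_eq_zero]
  exact eq_zero_of_two_mul (by linear_combination this)

omit S in
theorem P_trace : F.P 0 0 + F.P 1 1 + F.P 2 2 = 2 := by
  simp [P]; linear_combination -F.norm_n

/-- Inserting the homothety equation into the first `k`-derivative of `metric_YY` leaves `2 (R + m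
r) P = 0`, and `P` has trace 2. -/
theorem R_eq : R = -(m * F.r) := by
  have h0 : ∀ i, 2 * ((R + m * F.r) * F.P i i) = 0 := fun i => by
    linear_combination S.metric_YY_deriv i i - 2 * F.r * S.homothety i i
  have h1 : 2 * (R + m * F.r) = 0 := by
    have := P_trace (F := F)
    linear_combination eq_zero_of_two_mul (h0 0) + eq_zero_of_two_mul (h0 1)
      + eq_zero_of_two_mul (h0 2) - (R + m * F.r) * this
  linear_combination eq_zero_of_two_mul h1

theorem two_Y_N_diag (i : Fin 3) : F.Y i (N i) = m * F.P i i - F.n i * N i := by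
  rw [← sub_eq_zero]
  exact eq_zero_of_two_mul (by linear_combination S.homothety i i)

/-- The symmetric part of the covariant derivative of `N` is `m P`; its antisymmetric part is
tangential, and on a surface such a tensor is a function `β` times the area form `J`. -/
theorem exists_curl : ∃ β : A, F.k β = 0 ∧ F.Z β = 0 ∧
    ∀ i j, F.Y i (N j) = m * F.P i j - F.n j * N i + β * F.J i j := by
  obtain ⟨c, hc⟩ : ∃ c : ℝ, c * 2 = 1 := ⟨1 / 2, by norm_num⟩
  have hc : algebraMap ℝ A c * 2 = 1 := by
    rw [← map_ofNat (algebraMap ℝ A) 2, ← map_mul, hc, map_one]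
  have h01 := S.homothety 0 1
  have h02 := S.homothety 0 2
  have h12 := S.homothety 1 2
  have t0 := S.Y_N_tangent 0
  have t1 := S.Y_N_tangent 1
  have t2 := S.Y_N_tangent 2
  have hN := S.n_N
  have d0 := S.two_Y_N_diag 0
  have d1 := S.two_Y_N_diag 1
  have d2 := S.two_Y_N_diag 2
  have hn := F.norm_n
  -- The vector `q` is dual to the antisymmetric part of `Y i (N j) + n j * N i`.
  obtain ⟨q0, hq0⟩ : ∃ q, q = algebraMap ℝ A c * (F.Y 1 (N 2) + F.n 2 * N 1 - F.Y 2 (N 1) - F.n 1 * N 2) := ⟨_, rfl⟩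
  obtain ⟨q1, hq1⟩ : ∃ q, q = algebraMap ℝ A c * (F.Y 2 (N 0) + F.n 0 * N 2 - F.Y 0 (N 2) - F.n 2 * N 0) := ⟨_, rfl⟩
  obtain ⟨q2, hq2⟩ : ∃ q, q = algebraMap ℝ A c * (F.Y 0 (N 1) + F.n 1 * N 0 - F.Y 1 (N 0) - F.n 0 * N 1) := ⟨_, rfl⟩
  have e01 : F.Y 0 (N 1) = m * F.P 0 1 - F.n 1 * N 0 + q2 := by
    linear_combination (algebraMap ℝ A c) * h01 - hq2 - (F.Y 0 (N 1) + F.n 1 * N 0 - m * F.P 0 1) * hc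
  have e10 : F.Y 1 (N 0) = m * F.P 1 0 - F.n 0 * N 1 - q2 := by
    linear_combination (algebraMap ℝ A c) * h01 + hq2 - (F.Y 1 (N 0) + F.n 0 * N 1 - m * F.P 0 1) * hc - m * F.P_comm 1 0
  have e12 : F.Y 1 (N 2) = m * F.P 1 2 - F.n 2 * N 1 + q0 := by
    linear_combination (algebraMap ℝ A c) * h12 - hq0 - (F.Y 1 (N 2) + F.n 2 * N 1 - m * F.P 1 2) * hc
  have e21 : F.Y 2 (N 1) = m * F.P 2 1 - F.n 1 * N 2 - q0 := by
    linear_combination (algebraMap ℝ A c) * h12 + hq0 - (F.Y 2 (N 1) + F.n 1 * N 2 - m * F.P 1 2) * hc - m * F.P_comm 2 1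
  have e20 : F.Y 2 (N 0) = m * F.P 2 0 - F.n 0 * N 2 + q1 := by
    linear_combination (algebraMap ℝ A c) * h02 - hq1 - (F.Y 2 (N 0) + F.n 0 * N 2 - m * F.P 0 2) * hc - m * F.P_comm 2 0
  have e02 : F.Y 0 (N 2) = m * F.P 0 2 - F.n 2 * N 0 - q1 := by
    linear_combination (algebraMap ℝ A c) * h02 + hq1 - (F.Y 0 (N 2) + F.n 2 * N 0 - m * F.P 0 2) * hc
  rw [d0, e01, e02] at t0
  rw [d1, e10, e12] at t1
  rw [d2, e20, e21] at t2
  simp [P] at t0 t1 t2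
  -- Tangency means `q × n = 0`. As `n` is a unit vector, `q = (q · n) n`, so `β = q · n`.
  have r0 : q2 * F.n 1 = q1 * F.n 2 := by linear_combination t0 + (m * F.n 0 + N 0) * hn
  have r1 : q0 * F.n 2 = q2 * F.n 0 := by linear_combination t1 + (m * F.n 1 + N 1) * hn
  have r2 : q1 * F.n 0 = q0 * F.n 1 := by linear_combination t2 + (m * F.n 2 + N 2) * hn
  have s0 : (q0 * F.n 0 + q1 * F.n 1 + q2 * F.n 2) * F.n 0 = q0 := by
    linear_combination F.n 1 * r2 - F.n 2 * r1 + q0 * hn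
  have s1 : (q0 * F.n 0 + q1 * F.n 1 + q2 * F.n 2) * F.n 1 = q1 := by
    linear_combination F.n 2 * r0 - F.n 0 * r2 + q1 * hn
  have s2 : (q0 * F.n 0 + q1 * F.n 1 + q2 * F.n 2) * F.n 2 = q2 := by
    linear_combination F.n 0 * r1 - F.n 1 * r0 + q2 * hn
  refine ⟨q0 * F.n 0 + q1 * F.n 1 + q2 * F.n 2, ?_, ?_, ?_⟩
  · simp [hq0, hq1, hq2, F.k_n, S.k_N, F.k_Y]
  · simp [hq0, hq1, hq2, F.Z_n, S.Z_N, F.Z_Y]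
  · simp only [forall_fin_three, J]
    refine ⟨⟨?_, ?_, ?_⟩, ⟨?_, ?_, ?_⟩, ?_, ?_, ?_⟩ <;>
      simp [d0, d1, d2, e01, e10, e12, e21, e20, e02, s0, s1, s2, sub_eq_add_neg]

/-- Integrability of the equation for `Y i (N j)`: applying the commutator of the `Y i` to `N`
determines the gradient of `β`, namely `n × N`. The curvature of the sphere enters here. -/
theorem Y_curl {β : A}
    (hβ : ∀ i j, F.Y i (N j) = m * F.P i j - F.n j * N i + β * F.J i j) :
    F.Y 0 β = F.n 1 * N 2 - F.n 2 * N 1 ∧ F.Y 1 β = F.n 2 * N 0 - F.n 0 * N 2 ∧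
      F.Y 2 β = F.n 0 * N 1 - F.n 1 * N 0 := by
  have hN := S.n_N
  have hn := F.norm_n
  have comm : ∀ i j l, _ := fun i j l => F.Y_Y i j (N l)
  simp only [S.Z_N, hβ, map_add, map_sub, Derivation.leibniz, F.Y_n, smul_eq_mul, S.Y_m, Y_P, Y_J]
    at comm
  have c010 := comm 0 1 0
  have c011 := comm 0 1 1
  have c012 := comm 0 1 2
  have c020 := comm 0 2 0
  have c021 := comm 0 2 1
  have c022 := comm 0 2 2
  have c120 := comm 1 2 0
  have c121 := comm 1 2 1
  have c122 := comm 1 2 2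
  simp [P, J] at c010 c011 c012 c020 c021 c022 c120 c121 c122
  have k02 : F.Y 0 β * F.n 2 = F.n 0 * (F.n 0 * N 1 - F.n 1 * N 0) - N 1 := by
    linear_combination -c010
  have k12 : F.Y 1 β * F.n 2 = F.n 1 * (F.n 0 * N 1 - F.n 1 * N 0) + N 0 := by
    linear_combination -c011
  have k01 : F.Y 0 β * F.n 1 = F.n 0 * (F.n 2 * N 0 - F.n 0 * N 2) + N 2 := by
    linear_combination c020
  have k21 : F.Y 2 β * F.n 1 = F.n 2 * (F.n 2 * N 0 - F.n 0 * N 2) - N 0 := by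
    linear_combination c022
  have k10 : F.Y 1 β * F.n 0 = F.n 1 * (F.n 1 * N 2 - F.n 2 * N 1) - N 2 := by
    linear_combination -c121
  have k20 : F.Y 2 β * F.n 0 = F.n 2 * (F.n 1 * N 2 - F.n 2 * N 1) + N 1 := by
    linear_combination -c122
  have k22 : F.Y 2 β * F.n 2 = F.n 2 * (F.n 0 * N 1 - F.n 1 * N 0) := by
    linear_combination F.n_Y β - c012 - 2 * β * hn
  have k11 : F.Y 1 β * F.n 1 = F.n 1 * (F.n 2 * N 0 - F.n 0 * N 2) := by
    linear_combination F.n_Y β + c021 - 2 * β * hn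
  have k00 : F.Y 0 β * F.n 0 = F.n 0 * (F.n 1 * N 2 - F.n 2 * N 1) := by
    linear_combination F.n_Y β - c120 - 2 * β * hn
  refine ⟨?_, ?_, ?_⟩
  · linear_combination -F.Y 0 β * hn + F.n 0 * k00 + F.n 1 * k01 + F.n 2 * k02
  · linear_combination -F.Y 1 β * hn + F.n 0 * k10 + F.n 1 * k11 + F.n 2 * k12
  · linear_combination -F.Y 2 β * hn + F.n 0 * k20 + F.n 1 * k21 + F.n 2 * k22

/-- The unit sphere has no homothety that is not an isometry. Locally this is integrability once
more: the commutators of the `Y i` on `β`, whose gradient is `n × N`, give `2 m n = 0`. -/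
theorem m_eq_zero : m = 0 := by
  obtain ⟨β, -, hZ, hβ⟩ := S.exists_curl
  obtain ⟨h0, h1, h2⟩ := S.Y_curl hβ
  have hN := S.n_N
  have hn := F.norm_n
  have c01 := F.Y_Y 0 1 β
  have c02 := F.Y_Y 0 2 β
  have c12 := F.Y_Y 1 2 β
  simp only [h0, h1, h2, hZ, hβ, map_sub, Derivation.leibniz, F.Y_n, smul_eq_mul] at c01 c02 c12
  simp [P, J] at c01 c02 c12
  have e2 : 2 * (m * F.n 2) = 0 := by
    linear_combination c01 + 2 * F.n 2 * hN - 2 * N 2 * hn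
  have e1 : 2 * (m * F.n 1) = 0 := by
    linear_combination -c02 + 2 * F.n 1 * hN - 2 * N 1 * hn
  have e0 : 2 * (m * F.n 0) = 0 := by
    linear_combination c12 + 2 * F.n 0 * hN - 2 * N 0 * hn
  linear_combination -m * hn + F.n 0 * eq_zero_of_two_mul e0 + F.n 1 * eq_zero_of_two_mul e1
    + F.n 2 * eq_zero_of_two_mul e2

/-- The flat Kerr-Schild vector fields act on the rays as infinitesimal rotations with a constant
axis `b`, which is the axis of symmetry unless the twist vanishes. -/
theorem exists_axis : m = 0 ∧ h = 0 ∧ R = 0 ∧ (F.k B = 0 ∧ F.Z B = 0 ∧ ∀ i, F.Y i B = 0) ∧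
    ∃ b : Fin 3 → A, (∀ j, F.k (b j) = 0 ∧ F.Z (b j) = 0 ∧ ∀ i, F.Y i (b j) = 0) ∧
      F.α * b 0 = 0 ∧ F.α * b 1 = 0 ∧ N 0 = b 1 * F.n 2 - b 2 * F.n 1 ∧
      N 1 = b 2 * F.n 0 - b 0 * F.n 2 ∧ N 2 = b 0 * F.n 1 - b 1 * F.n 0 := by
  have hm := S.m_eq_zero
  subst hm
  have hR : R = 0 := by simpa using S.R_eq
  subst hR
  have hh : h = 0 := by simpa [S.Z_B] using S.metric_ZZ.symm
  subst hh
  obtain ⟨β, hk, hZ, hβ⟩ := S.exists_curl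
  obtain ⟨h0, h1, h2⟩ := S.Y_curl hβ
  have hN := S.n_N
  have hn := F.norm_n
  -- The axis is `b = n × N + β n`: its tangential part is recovered from `N = b × n`, its normal
  -- part is the curl.
  obtain ⟨b, hb⟩ : ∃ b : Fin 3 → A, b = ![F.n 1 * N 2 - F.n 2 * N 1 + β * F.n 0,
    F.n 2 * N 0 - F.n 0 * N 2 + β * F.n 1, F.n 0 * N 1 - F.n 1 * N 0 + β * F.n 2] := ⟨_, rfl⟩
  have hb0 : b 0 = F.n 1 * N 2 - F.n 2 * N 1 + β * F.n 0 := by simp [hb]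
  have hb1 : b 1 = F.n 2 * N 0 - F.n 0 * N 2 + β * F.n 1 := by simp [hb]
  have hb2 : b 2 = F.n 0 * N 1 - F.n 1 * N 0 + β * F.n 2 := by simp [hb]
  have e0 : N 0 = b 1 * F.n 2 - b 2 * F.n 1 := by
    rw [hb1, hb2]; linear_combination -N 0 * hn + F.n 0 * hN
  have e1 : N 1 = b 2 * F.n 0 - b 0 * F.n 2 := by
    rw [hb0, hb2]; linear_combination -N 1 * hn + F.n 1 * hN
  have e2 : N 2 = b 0 * F.n 1 - b 1 * F.n 0 := by
    rw [hb0, hb1]; linear_combination -N 2 * hn + F.n 2 * hN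
  have hkb : ∀ j, F.k (b j) = 0 := by
    simp [forall_fin_three, hb0, hb1, hb2, hk, F.k_n, S.k_N]
  have hZb : ∀ j, F.Z (b j) = 0 := by
    simp [forall_fin_three, hb0, hb1, hb2, hZ, F.Z_n, S.Z_N]
  have hYb : ∀ i j, F.Y i (b j) = 0 := by
    simp only [forall_fin_three, hb0, hb1, hb2, map_add, map_sub, Derivation.leibniz, hβ, F.Y_n,
      smul_eq_mul, h0, h1, h2]
    simp [P, J]
    refine ⟨⟨?_, ?_, ?_⟩, ⟨?_, ?_, ?_⟩, ?_, ?_, ?_⟩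
    · linear_combination -β * hn
    · linear_combination N 2 * hn - F.n 2 * hN
    · linear_combination F.n 1 * hN - N 1 * hn
    · linear_combination F.n 2 * hN - N 2 * hn
    · linear_combination -β * hn
    · linear_combination N 0 * hn - F.n 0 * hN
    · linear_combination N 1 * hn - F.n 1 * hN
    · linear_combination F.n 0 * hN - N 0 * hn
    · linear_combination -β * hn
  have hZB : F.Z B = 0 := S.Z_B
  have hYB : F.Y 0 B = F.α * (b 0 * F.n 2) ∧ F.Y 1 B = F.α * (b 1 * F.n 2) ∧
      F.Y 2 B = -F.α * (b 0 * F.n 0 + b 1 * F.n 1) := by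
    have f0 := S.form_Y 0
    have f1 := S.form_Y 1
    have f2 := S.form_Y 2
    simp only [e0, e1, map_sub, Derivation.leibniz, hYb, F.Y_n, smul_eq_mul] at f0 f1 f2
    simp [P] at f0 f1 f2
    refine ⟨?_, ?_, ?_⟩
    · linear_combination f0
    · linear_combination f1
    · linear_combination f2
  obtain ⟨g0, g1, g2⟩ := hYB
  -- The integrability conditions of the equations for `Y i B` give `α (b 0 * n 1 - b 1 * n 0) n =
  -- 0`. Contracting with `n` and differentiating in the directions `Y 0` and `Y 1` isolates the two
  -- horizontal components of the axis.
  have key : F.α * b 0 = 0 ∧ F.α * b 1 = 0 := by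
    have c01 := F.Y_Y 0 1 B
    have c02 := F.Y_Y 0 2 B
    have c12 := F.Y_Y 1 2 B
    simp only [g0, g1, g2, hZB, map_neg, map_add, Derivation.leibniz, F.Y_n, hYb, F.Y_α,
      smul_eq_mul] at c01 c02 c12
    simp at c01 c02 c12
    have d1 : 2 * (F.α * F.n 1 * (b 0 * F.n 1 - b 1 * F.n 0)) = 0 := by
      linear_combination -c02 + 2 * F.α * b 0 * hn
    have d0 : 2 * (F.α * F.n 0 * (b 0 * F.n 1 - b 1 * F.n 0)) = 0 := by
      linear_combination c12 - 2 * F.α * b 1 * hn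
    have d2 : 2 * (F.α * F.n 2 * (b 0 * F.n 1 - b 1 * F.n 0)) = 0 := by
      linear_combination c01
    have d : F.α * (b 0 * F.n 1 - b 1 * F.n 0) = 0 := by
      linear_combination -F.α * (b 0 * F.n 1 - b 1 * F.n 0) * hn + F.n 0 * eq_zero_of_two_mul d0
        + F.n 1 * eq_zero_of_two_mul d1 + F.n 2 * eq_zero_of_two_mul d2
    have y0 := congrArg (F.Y 0) d
    have y1 := congrArg (F.Y 1) d
    simp only [map_sub, Derivation.leibniz, F.Y_n, hYb, F.Y_α, smul_eq_mul, map_zero] at y0 y1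
    simp at y0 y1
    refine ⟨?_, ?_⟩
    · linear_combination y1 + F.n 1 * d
    · linear_combination -y0 - F.n 0 * d
  refine ⟨rfl, rfl, rfl, ⟨S.k_B, hZB, ?_⟩, b, fun j => ⟨hkb j, hZb j, fun i => hYb i j⟩,
    key.1, key.2, e0, e1, e2⟩
  simp only [forall_fin_three, g0, g1, g2]
  refine ⟨?_, ?_, ?_⟩
  · linear_combination F.n 2 * key.1
  · linear_combination F.n 2 * key.2
  · linear_combination -F.n 0 * key.1 - F.n 1 * key.2

end Solution
end AdaptedFrame
end KerrSchild

/-! ### The frame of a twisting congruence of null lines -/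

namespace KerrSchild

/-- A ring of functions with commuting partial derivatives `D` with respect to the coordinates
`(t, x)`, and a congruence of null lines with tangent vectors `(-σ, n)` and affine parameter `r`,
where `x = r n + α e₃ × n`. -/
structure RayRing (A : Type*) [CommRing A] [Algebra ℝ A] where
  D : Fin 4 → Derivation ℝ A A
  x : Fin 3 → A
  α : A
  σ : A
  n : Fin 3 → A
  r : A
  r_inv : A
  s : A
  D_comm : ∀ i j f, D i (D j f) = D j (D i f)
  D_x : ∀ i j, D i (x j) = if i = j.succ then 1 else 0
  D_α : ∀ i, D i α = 0
  D_σ : ∀ i, D i σ = 0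
  σ_sq : σ * σ = 1
  norm_n : n 0 ^ 2 + n 1 ^ 2 + n 2 ^ 2 = 1
  x_zero : x 0 = r * n 0 - α * n 1
  x_one : x 1 = r * n 1 + α * n 0
  x_two : x 2 = r * n 2
  mul_r_inv : r * r_inv = 1
  mul_s : (r ^ 2 + α ^ 2 * n 2 ^ 2) * s = 1

namespace RayRing

variable {A : Type*} [CommRing A] [Algebra ℝ A] (K : RayRing A)

/-- The derivation with components `v`. -/
def comb (v : Fin 4 → A) : Derivation ℝ A A :=
  v 0 • K.D 0 + v 1 • K.D 1 + v 2 • K.D 2 + v 3 • K.D 3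

theorem comb_apply (v : Fin 4 → A) (f : A) :
    K.comb v f = v 0 * K.D 0 f + v 1 * K.D 1 f + v 2 * K.D 2 f + v 3 * K.D 3 f := by
  simp [comb]

theorem comb_comm (v w : Fin 4 → A) (f : A) : K.comb v (K.comb w f) - K.comb w (K.comb v f) =
    (K.comb v (w 0) - K.comb w (v 0)) * K.D 0 f + (K.comb v (w 1) - K.comb w (v 1)) * K.D 1 f
      + (K.comb v (w 2) - K.comb w (v 2)) * K.D 2 f
      + (K.comb v (w 3) - K.comb w (v 3)) * K.D 3 f := by
  simp only [comb_apply, map_add, Derivation.leibniz, smul_eq_mul]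
  rw [K.D_comm 1 0, K.D_comm 2 0, K.D_comm 3 0, K.D_comm 2 1, K.D_comm 3 1, K.D_comm 3 2]
  ring

theorem comb_x (v : Fin 4 → A) :
    K.comb v (K.x 0) = v 1 ∧ K.comb v (K.x 1) = v 2 ∧ K.comb v (K.x 2) = v 3 := by
  simp [comb_apply, K.D_x, Fin.ext_iff]

theorem comb_α (v : Fin 4 → A) : K.comb v K.α = 0 := by simp [comb_apply, K.D_α]

theorem comb_σ (v : Fin 4 → A) : K.comb v K.σ = 0 := by simp [comb_apply, K.D_σ]

theorem n_tangent (V : Derivation ℝ A A) :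
    K.n 0 * V (K.n 0) + K.n 1 * V (K.n 1) + K.n 2 * V (K.n 2) = 0 := by
  have := congrArg V K.norm_n
  simp [Derivation.leibniz_pow] at this
  exact AdaptedFrame.eq_zero_of_two_mul (by linear_combination this)

theorem comb_of_x (v : Fin 4 → A) : v 1 = K.comb v K.r * K.n 0 + K.r * K.comb v (K.n 0)
      - K.α * K.comb v (K.n 1) ∧
    v 2 = K.comb v K.r * K.n 1 + K.r * K.comb v (K.n 1) + K.α * K.comb v (K.n 0) ∧
    v 3 = K.comb v K.r * K.n 2 + K.r * K.comb v (K.n 2) := by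
  obtain ⟨h0, h1, h2⟩ := K.comb_x v
  rw [K.x_zero] at h0
  rw [K.x_one] at h1
  rw [K.x_two] at h2
  simp [comb_α] at h0 h1 h2
  refine ⟨?_, ?_, ?_⟩
  · linear_combination -h0
  · linear_combination -h1
  · linear_combination -h2

/-- Injectivity of `(c, v) ↦ c n + r v + α e₃ × v` on vectors `v` orthogonal to `n`. Projecting on
`n` and on `e₃ × n` produces the factor `r ^ 2 + α ^ 2 * n 2 ^ 2`, which is invertible, as is `r`.
-/
theorem eq_zero_of_ray {c v0 v1 v2 : A} (h0 : c * K.n 0 + K.r * v0 - K.α * v1 = 0)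
    (h1 : c * K.n 1 + K.r * v1 + K.α * v0 = 0) (h2 : c * K.n 2 + K.r * v2 = 0)
    (hv : K.n 0 * v0 + K.n 1 * v1 + K.n 2 * v2 = 0) : c = 0 ∧ v0 = 0 ∧ v1 = 0 ∧ v2 = 0 := by
  have hn := K.norm_n
  have e : c = K.α * (K.n 0 * v1 - K.n 1 * v0) := by
    linear_combination -c * hn + K.n 0 * h0 + K.n 1 * h1 + K.n 2 * h2 - K.r * hv
  have e1 : K.r * (K.n 0 * v1 - K.n 1 * v0) = K.α * K.n 2 * v2 := by
    linear_combination K.n 0 * h1 - K.n 1 * h0 - K.α * hv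
  have e2 : (K.r ^ 2 + K.α ^ 2 * K.n 2 ^ 2) * c = 0 := by
    linear_combination K.r ^ 2 * e + K.r * K.α * e1 + K.α ^ 2 * K.n 2 * h2
  have hc : c = 0 := by linear_combination -c * K.mul_s + K.s * e2
  subst hc
  have hv2 : v2 = 0 := by linear_combination -v2 * K.mul_r_inv + K.r_inv * h2
  subst hv2
  have e3 : K.n 0 * v1 - K.n 1 * v0 = 0 := by
    linear_combination -(K.n 0 * v1 - K.n 1 * v0) * K.mul_r_inv + K.r_inv * e1
  have e4 : (K.r ^ 2 + K.α ^ 2 * K.n 2 ^ 2) * v0 = 0 := by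
    linear_combination K.r * h0 + K.α * h1 + K.α ^ 2 * v0 * hn - K.α ^ 2 * K.n 0 * hv
      + K.α ^ 2 * K.n 1 * e3
  have e5 : (K.r ^ 2 + K.α ^ 2 * K.n 2 ^ 2) * v1 = 0 := by
    linear_combination K.r * h1 - K.α * h0 + K.α ^ 2 * v1 * hn - K.α ^ 2 * K.n 1 * hv
      - K.α ^ 2 * K.n 0 * e3
  refine ⟨rfl, ?_, ?_, rfl⟩
  · linear_combination -v0 * K.mul_s + K.s * e4
  · linear_combination -v1 * K.mul_s + K.s * e5

/-- A vector acts on `n` and `r` as its spatial part in the decomposition given by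
`x = r n + α e₃ × n`. -/
theorem comb_eq {v : Fin 4 → A} {c w0 w1 w2 : A} (h1 : v 1 = c * K.n 0 + K.r * w0 - K.α * w1)
    (h2 : v 2 = c * K.n 1 + K.r * w1 + K.α * w0) (h3 : v 3 = c * K.n 2 + K.r * w2)
    (hw : K.n 0 * w0 + K.n 1 * w1 + K.n 2 * w2 = 0) :
    K.comb v K.r = c ∧ K.comb v (K.n 0) = w0 ∧ K.comb v (K.n 1) = w1 ∧ K.comb v (K.n 2) = w2 := by
  obtain ⟨g1, g2, g3⟩ := K.comb_of_x v
  have := K.eq_zero_of_ray (c := K.comb v K.r - c) (v0 := K.comb v (K.n 0) - w0)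
    (v1 := K.comb v (K.n 1) - w1) (v2 := K.comb v (K.n 2) - w2)
    (by linear_combination h1 - g1) (by linear_combination h2 - g2) (by linear_combination h3 - g3)
    (by linear_combination K.n_tangent (K.comb v) - hw)
  simpa only [sub_eq_zero] using this

/-- The tangential projector of the sphere of directions. -/
def P (i j : Fin 3) : A := (if i = j then 1 else 0) - K.n i * K.n j

theorem P_comm (i j : Fin 3) : K.P i j = K.P j i := by
  simp only [P, eq_comm (a := i), mul_comm]

theorem P_n (i : Fin 3) : K.P i 0 * K.n 0 + K.P i 1 * K.n 1 + K.P i 2 * K.n 2 = 0 := by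
  have hn := K.norm_n
  revert i
  simp [forall_fin_three, P]
  refine ⟨?_, ?_, ?_⟩
  · linear_combination -K.n 0 * hn
  · linear_combination -K.n 1 * hn
  · linear_combination -K.n 2 * hn

theorem n_P (j : Fin 3) : K.n 0 * K.P 0 j + K.n 1 * K.P 1 j + K.n 2 * K.P 2 j = 0 := by
  have hn := K.norm_n
  revert j
  simp [forall_fin_three, P]
  refine ⟨?_, ?_, ?_⟩
  · linear_combination -K.n 0 * hn
  · linear_combination -K.n 1 * hn
  · linear_combination -K.n 2 * hn

theorem P_P (i j : Fin 3) :
    K.P i 0 * K.P j 0 + K.P i 1 * K.P j 1 + K.P i 2 * K.P j 2 = K.P i j := by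
  have hn := K.norm_n
  revert i j
  simp [forall_fin_three, P]
  refine ⟨⟨?_, ?_, ?_⟩, ⟨?_, ?_, ?_⟩, ?_, ?_, ?_⟩
  · linear_combination K.n 0 * K.n 0 * hn
  · linear_combination K.n 0 * K.n 1 * hn
  · linear_combination K.n 0 * K.n 2 * hn
  · linear_combination K.n 1 * K.n 0 * hn
  · linear_combination K.n 1 * K.n 1 * hn
  · linear_combination K.n 1 * K.n 2 * hn
  · linear_combination K.n 2 * K.n 0 * hn
  · linear_combination K.n 2 * K.n 1 * hn
  · linear_combination K.n 2 * K.n 2 * hn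

/-- The components of the ray vector. -/
def kVec : Fin 4 → A := ![-K.σ, K.n 0, K.n 1, K.n 2]

/-- The components of the time translation. -/
def zVec : Fin 4 → A := ![K.σ, 0, 0, 0]

/-- The components of the lifts of the tangential gradients of the sphere of directions. -/
def yVec (i : Fin 3) : Fin 4 → A := ![-(K.σ * K.α * (K.n 1 * K.P i 0 - K.n 0 * K.P i 1)),
  K.r * K.P i 0 - K.α * K.P i 1, K.r * K.P i 1 + K.α * K.P i 0, K.r * K.P i 2]

@[simp] theorem kVec_zero : K.kVec 0 = -K.σ := rfl
@[simp] theorem kVec_one : K.kVec 1 = K.n 0 := rfl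
@[simp] theorem kVec_two : K.kVec 2 = K.n 1 := rfl
@[simp] theorem kVec_three : K.kVec 3 = K.n 2 := rfl
@[simp] theorem zVec_zero : K.zVec 0 = K.σ := rfl
@[simp] theorem zVec_one : K.zVec 1 = 0 := rfl
@[simp] theorem zVec_two : K.zVec 2 = 0 := rfl
@[simp] theorem zVec_three : K.zVec 3 = 0 := rfl
@[simp] theorem yVec_zero (i : Fin 3) :
    K.yVec i 0 = -(K.σ * K.α * (K.n 1 * K.P i 0 - K.n 0 * K.P i 1)) := rfl
@[simp] theorem yVec_one (i : Fin 3) : K.yVec i 1 = K.r * K.P i 0 - K.α * K.P i 1 := rfl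
@[simp] theorem yVec_two (i : Fin 3) : K.yVec i 2 = K.r * K.P i 1 + K.α * K.P i 0 := rfl
@[simp] theorem yVec_three (i : Fin 3) : K.yVec i 3 = K.r * K.P i 2 := rfl

theorem comb_kVec : K.comb K.kVec K.r = 1 ∧ K.comb K.kVec (K.n 0) = 0 ∧
    K.comb K.kVec (K.n 1) = 0 ∧ K.comb K.kVec (K.n 2) = 0 :=
  K.comb_eq (by simp) (by simp) (by simp) (by simp)

theorem comb_zVec : K.comb K.zVec K.r = 0 ∧ K.comb K.zVec (K.n 0) = 0 ∧
    K.comb K.zVec (K.n 1) = 0 ∧ K.comb K.zVec (K.n 2) = 0 :=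
  K.comb_eq (by simp) (by simp) (by simp) (by simp)

theorem comb_yVec (i : Fin 3) : K.comb (K.yVec i) K.r = 0 ∧ K.comb (K.yVec i) (K.n 0) = K.P i 0 ∧
    K.comb (K.yVec i) (K.n 1) = K.P i 1 ∧ K.comb (K.yVec i) (K.n 2) = K.P i 2 :=
  K.comb_eq (by simp) (by simp) (by simp) (by linear_combination K.P_n i)

theorem comb_P (v : Fin 4 → A) (i j : Fin 3) :
    K.comb v (K.P i j) = -(K.comb v (K.n i) * K.n j) - K.n i * K.comb v (K.n j) := by
  have h0 : K.comb v (if i = j then 1 else 0) = 0 := by split_ifs <;> simp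
  simp only [P, map_sub, Derivation.leibniz, smul_eq_mul, h0]
  ring

theorem kVec_n (j : Fin 3) : K.comb K.kVec (K.n j) = 0 := by
  revert j; simpa only [forall_fin_three] using K.comb_kVec.2

theorem zVec_n (j : Fin 3) : K.comb K.zVec (K.n j) = 0 := by
  revert j; simpa only [forall_fin_three] using K.comb_zVec.2

theorem yVec_n (i j : Fin 3) : K.comb (K.yVec i) (K.n j) = K.P i j := by
  revert j; simpa only [forall_fin_three] using (K.comb_yVec i).2

/-- The adapted frame of the congruence. -/
def frame : AdaptedFrame A where
  α := K.α
  n := K.n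
  r := K.r
  k := K.comb K.kVec
  Z := K.comb K.zVec
  Y := fun i => K.comb (K.yVec i)
  -- The spatial part of the bracket closes up by itself, so `c` is whatever the time components
  -- leave over, expressed through `Z = σ ∂_t`. Its value is never needed: the bracket relation is
  -- only applied to functions that `Z` annihilates.
  c := fun i j => K.σ * (K.comb (K.yVec i) (K.yVec j 0) - K.comb (K.yVec j) (K.yVec i 0)
    - K.n i * K.yVec j 0 + K.n j * K.yVec i 0)
  norm_n := K.norm_n
  k_α := K.comb_α _
  Z_α := K.comb_α _
  Y_α := fun _ => K.comb_α _
  k_n := K.kVec_n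
  Z_n := K.zVec_n
  Y_n := K.yVec_n
  k_r := K.comb_kVec.1
  Z_r := K.comb_zVec.1
  Y_r := fun i => (K.comb_yVec i).1
  k_Z := fun f => by
    rw [← sub_eq_zero, comb_comm]
    simp [comb_σ, zVec_n]
  k_Y := fun i f => by
    rw [← sub_eq_zero, comb_comm]
    simp [comb_σ, comb_α, kVec_n, yVec_n, comb_P, K.comb_kVec.1]
  Z_Y := fun i f => by
    rw [← sub_eq_zero, comb_comm]
    simp [comb_σ, comb_α, zVec_n, comb_P, K.comb_zVec.1]
  Y_Y := fun i j f => by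
    have h1 : K.comb (K.yVec i) (K.yVec j 1) - K.comb (K.yVec j) (K.yVec i 1)
        = K.n i * K.yVec j 1 - K.n j * K.yVec i 1 := by
      simp [comb_α, yVec_n, comb_P, (K.comb_yVec _).1]
      linear_combination (-K.r * K.n 0 + K.α * K.n 1) * K.P_comm i j
    have h2 : K.comb (K.yVec i) (K.yVec j 2) - K.comb (K.yVec j) (K.yVec i 2)
        = K.n i * K.yVec j 2 - K.n j * K.yVec i 2 := by
      simp [comb_α, yVec_n, comb_P, (K.comb_yVec _).1]
      linear_combination (-K.r * K.n 1 - K.α * K.n 0) * K.P_comm i j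
    have h3 : K.comb (K.yVec i) (K.yVec j 3) - K.comb (K.yVec j) (K.yVec i 3)
        = K.n i * K.yVec j 3 - K.n j * K.yVec i 3 := by
      simp [yVec_n, comb_P, (K.comb_yVec _).1]
      linear_combination (-K.r * K.n 2) * K.P_comm i j
    rw [comb_comm, K.comb_apply (K.yVec j) f, K.comb_apply (K.yVec i) f, K.comb_apply K.zVec f,
      K.zVec_zero, K.zVec_one, K.zVec_two, K.zVec_three]
    linear_combination h1 * K.D 1 f + h2 * K.D 2 f + h3 * K.D 3 f
      - (K.comb (K.yVec i) (K.yVec j 0) - K.comb (K.yVec j) (K.yVec i 0)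
        - K.n i * K.yVec j 0 + K.n j * K.yVec i 0) * K.D 0 f * K.σ_sq
  n_Y := fun f => by
    simp only [comb_apply]
    simp
    linear_combination (-K.σ * K.α * K.n 1 * K.D 0 f + K.r * K.D 1 f + K.α * K.D 2 f) * K.n_P 0
      + (K.σ * K.α * K.n 0 * K.D 0 f + K.r * K.D 2 f - K.α * K.D 1 f) * K.n_P 1
      + (K.r * K.D 3 f) * K.n_P 2

theorem frame_twist (i : Fin 3) :
    K.frame.twist i = K.n 1 * K.P i 0 - K.n 0 * K.P i 1 := by
  revert i
  simp [forall_fin_three, AdaptedFrame.twist, frame, P]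
  refine ⟨?_, ?_, ?_⟩ <;> ring

/-- The frame spans all the coordinate derivatives. -/
theorem D_eq_zero {f : A} (hk : K.comb K.kVec f = 0) (hZ : K.comb K.zVec f = 0)
    (hY : ∀ i, K.comb (K.yVec i) f = 0) (i : Fin 4) : K.D i f = 0 := by
  simp only [comb_apply] at hk hZ hY
  simp at hk hZ hY
  have h0 : K.D 0 f = 0 := by linear_combination -K.D 0 f * K.σ_sq + K.σ * hZ
  -- For spatial `v`, put `c = v r` and `w = v n`. Then `v = c n + r w + α e₃ × w`, so up to
  -- multiples of `D 0 f = 0` one has `v f = c (k f) + ∑ w i (Y i f)`.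
  have h : ∀ v : Fin 4 → A, v 0 = 0 → K.comb v f = 0 := fun v hv => by
    obtain ⟨g1, g2, g3⟩ := K.comb_of_x v
    have ht := K.n_tangent (K.comb v)
    rw [comb_apply, hv]
    have hY0 := hY 0
    have hY1 := hY 1
    have hY2 := hY 2
    simp only [P, h0] at hY0 hY1 hY2
    simp at hY0 hY1 hY2
    rw [h0] at hk
    generalize K.comb v (K.n 0) = w0 at *
    generalize K.comb v (K.n 1) = w1 at *
    generalize K.comb v (K.n 2) = w2 at *
    generalize K.comb v K.r = c at *
    rw [g1, g2, g3]
    linear_combination c * hk + w0 * hY0 + w1 * hY1 + w2 * hY2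
      + (K.r * (K.n 0 * K.D 1 f + K.n 1 * K.D 2 f + K.n 2 * K.D 3 f)
        + K.α * (K.n 0 * K.D 2 f - K.n 1 * K.D 1 f)) * ht
  have h1 := h ![0, 1, 0, 0] rfl
  have h2 := h ![0, 0, 1, 0] rfl
  have h3 := h ![0, 0, 0, 1] rfl
  simp [comb_apply] at h1 h2 h3
  fin_cases i <;> assumption

/-- Translates derivatives of the components of `ξ` into those of `N`, `R` and `B`, through `ξ 0 = σ
(B - R)` and the differentiated relation `x = r n + α e₃ × n`. -/
theorem comb_ξ (ξ v : Fin 4 → A) :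
    K.comb v (ξ 0) = K.σ * (K.comb v (K.σ * ξ 0 + K.comb ξ K.r) - K.comb v (K.comb ξ K.r)) ∧
    K.comb v (ξ 1) = K.comb v (K.comb ξ K.r) * K.n 0 + K.comb ξ K.r * K.comb v (K.n 0)
      + K.comb v K.r * K.comb ξ (K.n 0) + K.r * K.comb v (K.comb ξ (K.n 0))
      - K.α * K.comb v (K.comb ξ (K.n 1)) ∧
    K.comb v (ξ 2) = K.comb v (K.comb ξ K.r) * K.n 1 + K.comb ξ K.r * K.comb v (K.n 1)
      + K.comb v K.r * K.comb ξ (K.n 1) + K.r * K.comb v (K.comb ξ (K.n 1))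
      + K.α * K.comb v (K.comb ξ (K.n 0)) ∧
    K.comb v (ξ 3) = K.comb v (K.comb ξ K.r) * K.n 2 + K.comb ξ K.r * K.comb v (K.n 2)
      + K.comb v K.r * K.comb ξ (K.n 2) + K.r * K.comb v (K.comb ξ (K.n 2)) := by
  obtain ⟨h1, h2, h3⟩ := K.comb_of_x ξ
  replace h1 := congrArg (K.comb v) h1
  replace h2 := congrArg (K.comb v) h2
  replace h3 := congrArg (K.comb v) h3
  simp only [map_add, map_sub, Derivation.leibniz, smul_eq_mul, comb_α, comb_σ] at *
  refine ⟨?_, ?_, ?_, ?_⟩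
  · linear_combination -K.comb v (ξ 0) * K.σ_sq
  · linear_combination h1
  · linear_combination h2
  · linear_combination h3

theorem n_N_tangent (ξ : Fin 4 → A) (V : Derivation ℝ A A) :
    K.n 0 * V (K.comb ξ (K.n 0)) + K.n 1 * V (K.comb ξ (K.n 1)) + K.n 2 * V (K.comb ξ (K.n 2))
      + (K.comb ξ (K.n 0) * V (K.n 0) + K.comb ξ (K.n 1) * V (K.n 1)
        + K.comb ξ (K.n 2) * V (K.n 2)) = 0 := by
  have := congrArg V (K.n_tangent (K.comb ξ))
  simp only [map_add, Derivation.leibniz, smul_eq_mul, map_zero] at this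
  linear_combination this

/-- The covector `(σ, n)`. -/
def lForm : Fin 4 → A := ![K.σ, K.n 0, K.n 1, K.n 2]

/-- The flat metric coefficients. -/
def minkowski : Fin 4 → A := ![-1, 1, 1, 1]

/-- The equations of flat Kerr-Schild vector fields `ξ`. -/
structure FlatKSVF (ξ : Fin 4 → A) (h m : A) : Prop where
  metric : ∀ i j, minkowski j * K.D i (ξ j) + minkowski i * K.D j (ξ i) = h * K.lForm i * K.lForm j
  form : ∀ i, K.comb ξ (K.lForm i) + (K.lForm 0 * K.D i (ξ 0) + K.lForm 1 * K.D i (ξ 1)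
    + K.lForm 2 * K.D i (ξ 2) + K.lForm 3 * K.D i (ξ 3)) = m * K.lForm i

/-! ### Reduction of the flat equations to the adapted frame -/

namespace FlatKSVF

variable {K} {ξ : Fin 4 → A} {h m : A} (S : K.FlatKSVF ξ h m)
include S

theorem comb_form (v : Fin 4 → A) :
    v 1 * K.comb ξ (K.n 0) + v 2 * K.comb ξ (K.n 1) + v 3 * K.comb ξ (K.n 2)
      + (K.σ * K.comb v (ξ 0) + K.n 0 * K.comb v (ξ 1) + K.n 1 * K.comb v (ξ 2)
        + K.n 2 * K.comb v (ξ 3))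
      = m * (v 0 * K.σ + v 1 * K.n 0 + v 2 * K.n 1 + v 3 * K.n 2) := by
  have f0 := S.form 0
  have f1 := S.form 1
  have f2 := S.form 2
  have f3 := S.form 3
  simp [lForm, comb_σ] at f0 f1 f2 f3
  simp only [comb_apply _ v]
  linear_combination v 0 * f0 + v 1 * f1 + v 2 * f2 + v 3 * f3

theorem comb_metric (v w : Fin 4 → A) :
    -(w 0 * K.comb v (ξ 0)) + w 1 * K.comb v (ξ 1) + w 2 * K.comb v (ξ 2) + w 3 * K.comb v (ξ 3)
      + (-(v 0 * K.comb w (ξ 0)) + v 1 * K.comb w (ξ 1) + v 2 * K.comb w (ξ 2)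
        + v 3 * K.comb w (ξ 3))
      = h * (v 0 * K.σ + v 1 * K.n 0 + v 2 * K.n 1 + v 3 * K.n 2)
        * (w 0 * K.σ + w 1 * K.n 0 + w 2 * K.n 1 + w 3 * K.n 2) := by
  have g := S.metric
  simp only [Fin.forall_fin_succ] at g
  simp [lForm, minkowski] at g
  obtain ⟨⟨g00, g01, g02, g03⟩, ⟨g10, g11, g12, g13⟩, ⟨g20, g21, g22, g23⟩,
    ⟨g30, g31, g32, g33⟩⟩ := g
  simp only [comb_apply]
  linear_combination v 0 * w 0 * g00 + v 0 * w 1 * g01 + v 0 * w 2 * g02 + v 0 * w 3 * g03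
    + v 1 * w 0 * g10 + v 1 * w 1 * g11 + v 1 * w 2 * g12 + v 1 * w 3 * g13
    + v 2 * w 0 * g20 + v 2 * w 1 * g21 + v 2 * w 2 * g22 + v 2 * w 3 * g23
    + v 3 * w 0 * g30 + v 3 * w 1 * g31 + v 3 * w 2 * g32 + v 3 * w 3 * g33

/-- The ray vector is `ℓ` with raised index, and `ℓ(k) = 0`. Contracting the metric equation with
`k` therefore kills its right side, and subtracting the result from the form equation gives `[ξ, k]
= m k` in components. -/
theorem k_ξ : K.comb K.kVec (ξ 0) = m * K.σ ∧
    K.comb ξ (K.n 0) - K.comb K.kVec (ξ 1) = m * K.n 0 ∧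
    K.comb ξ (K.n 1) - K.comb K.kVec (ξ 2) = m * K.n 1 ∧
    K.comb ξ (K.n 2) - K.comb K.kVec (ξ 3) = m * K.n 2 := by
  have f0 := S.comb_form ![1, 0, 0, 0]
  have f1 := S.comb_form ![0, 1, 0, 0]
  have f2 := S.comb_form ![0, 0, 1, 0]
  have f3 := S.comb_form ![0, 0, 0, 1]
  have g0 := S.comb_metric ![1, 0, 0, 0] K.kVec
  have g1 := S.comb_metric ![0, 1, 0, 0] K.kVec
  have g2 := S.comb_metric ![0, 0, 1, 0] K.kVec
  have g3 := S.comb_metric ![0, 0, 0, 1] K.kVec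
  have hn := K.norm_n
  have hσ := K.σ_sq
  simp at f0 f1 f2 f3 g0 g1 g2 g3
  refine ⟨?_, ?_, ?_, ?_⟩
  · linear_combination f0 - g0 + K.σ * h * hσ - K.σ * h * hn
  · linear_combination f1 - g1 + K.n 0 * h * hσ - K.n 0 * h * hn
  · linear_combination f2 - g2 + K.n 1 * h * hσ - K.n 1 * h * hn
  · linear_combination f3 - g3 + K.n 2 * h * hσ - K.n 2 * h * hn

theorem comm_k (f : A) : K.comb ξ (K.comb K.kVec f) - K.comb K.kVec (K.comb ξ f)
    = m * K.comb K.kVec f := by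
  obtain ⟨a0, a1, a2, a3⟩ := S.k_ξ
  rw [comb_comm, K.comb_apply K.kVec f]
  simp [comb_σ]
  linear_combination -K.D 0 f * a0 + K.D 1 f * a1 + K.D 2 f * a2 + K.D 3 f * a3

theorem k_R : K.comb K.kVec (K.comb ξ K.r) = -m := by
  have := S.comm_k K.r
  rw [K.comb_kVec.1] at this
  simp at this
  linear_combination -this

/-- The ray equations come from `[ξ, k] = m k`. The others are the two tensor equations evaluated on
`Z` and `Y i`, simplified by `σ ^ 2 = 1`, `|n| = 1`, the tangency of `N` and the derivative of that
tangency. -/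
theorem solution : K.frame.Solution (fun i => K.comb ξ (K.n i)) (K.comb ξ K.r)
    (K.σ * ξ 0 + K.comb ξ K.r) m h := by
  have hn := K.norm_n
  have hσ := K.σ_sq
  have hz := K.comb_ξ ξ K.zVec
  have tz := K.n_N_tangent ξ (K.comb K.zVec)
  simp only [zVec_n, K.comb_zVec.1, mul_zero, add_zero, zero_mul] at hz tz
  have hy := fun i => K.comb_ξ ξ (K.yVec i)
  have ty := fun i => K.n_N_tangent ξ (K.comb (K.yVec i))
  simp only [yVec_n, (K.comb_yVec _).1, add_zero, zero_mul] at hy ty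
  obtain ⟨z0, z1, z2, z3⟩ := hz
  constructor
  · exact K.n_tangent (K.comb ξ)
  · intro i
    change K.comb K.kVec (K.comb ξ (K.n i)) = 0
    have := S.comm_k (K.n i)
    rw [K.kVec_n] at this
    simpa using this
  · exact S.k_R
  · change K.comb K.kVec (K.σ * ξ 0 + K.comb ξ K.r) = 0
    simp only [map_add, Derivation.leibniz, comb_σ, S.k_R, S.k_ξ.1, smul_eq_mul]
    linear_combination m * hσ
  · change K.comb K.zVec (K.σ * ξ 0 + K.comb ξ K.r) + K.α * (K.n 1 * K.comb K.zVec
      (K.comb ξ (K.n 0)) - K.n 0 * K.comb K.zVec (K.comb ξ (K.n 1))) = m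
    have := S.comb_form K.zVec
    rw [z0, z1, z2, z3] at this
    simp only [zVec_zero, zVec_one, zVec_two, zVec_three] at this
    linear_combination this - (K.comb K.zVec (K.σ * ξ 0 + K.comb ξ K.r)
        - K.comb K.zVec (K.comb ξ K.r) - m) * hσ
      - K.comb K.zVec (K.comb ξ K.r) * hn - K.r * tz
  · intro i
    change K.comb (K.yVec i) (K.σ * ξ 0 + K.comb ξ K.r) + K.α * (K.comb ξ (K.n 1) * K.P i 0
      - K.comb ξ (K.n 0) * K.P i 1 + (K.n 1 * K.comb (K.yVec i) (K.comb ξ (K.n 0))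
      - K.n 0 * K.comb (K.yVec i) (K.comb ξ (K.n 1)))) = 0
    obtain ⟨y0, y1, y2, y3⟩ := hy i
    have := S.comb_form (K.yVec i)
    rw [y0, y1, y2, y3] at this
    simp only [yVec_zero, yVec_one, yVec_two, yVec_three] at this
    linear_combination this - (K.comb (K.yVec i) (K.σ * ξ 0 + K.comb ξ K.r)
        - K.comb (K.yVec i) (K.comb ξ K.r) + m * K.α * (K.n 1 * K.P i 0 - K.n 0 * K.P i 1)) * hσ
      - K.comb (K.yVec i) (K.comb ξ K.r) * hn - K.comb ξ K.r * K.P_n i - K.r * ty i + m * K.r * K.P_n i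
  · change 2 * (K.comb K.zVec (K.comb ξ K.r)
      - K.comb K.zVec (K.σ * ξ 0 + K.comb ξ K.r)) = h
    have := S.comb_metric K.zVec K.zVec
    rw [z0] at this
    simp only [zVec_zero, zVec_one, zVec_two, zVec_three] at this
    linear_combination this + 2 * (K.comb K.zVec (K.σ * ξ 0 + K.comb ξ K.r)
        - K.comb K.zVec (K.comb ξ K.r)) * hσ + h * (K.σ * K.σ + 1) * hσ
  · intro i
    change -(K.comb (K.yVec i) (K.σ * ξ 0 + K.comb ξ K.r) - K.α * K.frame.twist i *
      K.comb K.zVec (K.σ * ξ 0 + K.comb ξ K.r)) + K.comb (K.yVec i) (K.comb ξ K.r)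
      + K.r ^ 2 * (K.P i 0 * K.comb K.zVec (K.comb ξ (K.n 0))
        + K.P i 1 * K.comb K.zVec (K.comb ξ (K.n 1))
        + K.P i 2 * K.comb K.zVec (K.comb ξ (K.n 2)))
      + K.α ^ 2 * (K.P i 0 * K.comb K.zVec (K.comb ξ (K.n 0))
        + K.P i 1 * K.comb K.zVec (K.comb ξ (K.n 1))) = 0
    obtain ⟨y0, y1, y2, y3⟩ := hy i
    have := S.comb_metric K.zVec (K.yVec i)
    rw [y0, z0, z1, z2, z3] at this
    simp only [zVec_zero, zVec_one, zVec_two, zVec_three, yVec_zero, yVec_one, yVec_two,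
      yVec_three] at this
    rw [frame_twist]
    linear_combination this + (K.comb (K.yVec i) (K.σ * ξ 0 + K.comb ξ K.r)
        - K.comb (K.yVec i) (K.comb ξ K.r)) * hσ - K.α * (K.n 1 * K.P i 0 - K.n 0 * K.P i 1)
        * (K.comb K.zVec (K.σ * ξ 0 + K.comb ξ K.r) - K.comb K.zVec (K.comb ξ K.r)) * hσ
      - K.comb K.zVec (K.comb ξ K.r) * K.r * K.P_n i - h * K.σ * K.σ * K.α * (K.n 1 * K.P i 0 - K.n 0 * K.P i 1) * hσ
      + h * K.σ * K.σ * K.r * K.P_n i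
  · intro i j
    change K.α * (K.frame.twist i * K.comb (K.yVec j) (K.σ * ξ 0 + K.comb ξ K.r)
        + K.frame.twist j * K.comb (K.yVec i) (K.σ * ξ 0 + K.comb ξ K.r))
      + 2 * K.comb ξ K.r * K.r * K.P i j
      + K.r ^ 2 * (K.P i 0 * K.comb (K.yVec j) (K.comb ξ (K.n 0))
        + K.P i 1 * K.comb (K.yVec j) (K.comb ξ (K.n 1))
        + K.P i 2 * K.comb (K.yVec j) (K.comb ξ (K.n 2))
        + (K.P j 0 * K.comb (K.yVec i) (K.comb ξ (K.n 0))
        + K.P j 1 * K.comb (K.yVec i) (K.comb ξ (K.n 1))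
        + K.P j 2 * K.comb (K.yVec i) (K.comb ξ (K.n 2))))
      + K.α ^ 2 * (K.P i 0 * K.comb (K.yVec j) (K.comb ξ (K.n 0))
        + K.P i 1 * K.comb (K.yVec j) (K.comb ξ (K.n 1))
        + (K.P j 0 * K.comb (K.yVec i) (K.comb ξ (K.n 0))
        + K.P j 1 * K.comb (K.yVec i) (K.comb ξ (K.n 1)))) = 0
    obtain ⟨y0, y1, y2, y3⟩ := hy i
    obtain ⟨w0, w1, w2, w3⟩ := hy j
    have := S.comb_metric (K.yVec i) (K.yVec j)
    rw [y0, y1, y2, y3, w0, w1, w2, w3] at this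
    simp only [yVec_zero, yVec_one, yVec_two, yVec_three] at this
    rw [frame_twist, frame_twist]
    linear_combination this - K.α * ((K.n 1 * K.P j 0 - K.n 0 * K.P j 1)
        * (K.comb (K.yVec i) (K.σ * ξ 0 + K.comb ξ K.r) - K.comb (K.yVec i) (K.comb ξ K.r))
        + (K.n 1 * K.P i 0 - K.n 0 * K.P i 1)
        * (K.comb (K.yVec j) (K.σ * ξ 0 + K.comb ξ K.r) - K.comb (K.yVec j) (K.comb ξ K.r))) * hσ
      - K.comb (K.yVec i) (K.comb ξ K.r) * K.r * K.P_n j - K.comb (K.yVec j) (K.comb ξ K.r) * K.r * K.P_n i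
      - 2 * K.comb ξ K.r * K.r * K.P_P i j
      + h * (-(K.σ * K.σ * K.α * (K.n 1 * K.P j 0 - K.n 0 * K.P j 1))
        + K.r * (K.P j 0 * K.n 0 + K.P j 1 * K.n 1 + K.P j 2 * K.n 2) + K.α * (K.n 1 * K.P j 0 - K.n 0 * K.P j 1))
        * (-(K.α * (K.n 1 * K.P i 0 - K.n 0 * K.P i 1)) * hσ + K.r * K.P_n i)

/-- The flat Kerr-Schild vector fields are combinations of the time translation and of rotations
around the axis of symmetry (around all axes if there is no twist). -/
theorem exists_rotation : m = 0 ∧ h = 0 ∧ (∀ i, K.D i (ξ 0) = 0) ∧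
    ∃ b : Fin 3 → A, (∀ i j, K.D i (b j) = 0) ∧ K.α * b 0 = 0 ∧ K.α * b 1 = 0 ∧
      ξ 1 = b 1 * K.x 2 - b 2 * K.x 1 ∧ ξ 2 = b 2 * K.x 0 - b 0 * K.x 2 ∧
      ξ 3 = b 0 * K.x 1 - b 1 * K.x 0 := by
  obtain ⟨hm, hh, hR, hB, b, hb, hb0, hb1, e0, e1, e2⟩ := S.solution.exists_axis
  obtain ⟨h1, h2, h3⟩ := K.comb_of_x ξ
  refine ⟨hm, hh, fun i => ?_, b, fun i j => K.D_eq_zero (hb j).1 (hb j).2.1 (hb j).2.2 i,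
    hb0, hb1, ?_, ?_, ?_⟩
  · have := K.D_eq_zero hB.1 hB.2.1 hB.2.2 i
    rw [hR] at this
    simp [K.D_σ] at this
    linear_combination -K.D i (ξ 0) * K.σ_sq + K.σ * this
  · change K.α * b 0 = 0 at hb0
    change K.comb ξ (K.n 0) = b 1 * K.n 2 - b 2 * K.n 1 at e0
    change K.comb ξ (K.n 1) = b 2 * K.n 0 - b 0 * K.n 2 at e1
    rw [h1, hR, e0, e1, K.x_one, K.x_two]
    linear_combination K.n 2 * hb0
  · change K.α * b 1 = 0 at hb1
    change K.comb ξ (K.n 0) = b 1 * K.n 2 - b 2 * K.n 1 at e0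
    change K.comb ξ (K.n 1) = b 2 * K.n 0 - b 0 * K.n 2 at e1
    rw [h2, hR, e0, e1, K.x_zero, K.x_two]
    linear_combination K.n 2 * hb1
  · change K.α * b 0 = 0 at hb0
    change K.α * b 1 = 0 at hb1
    change K.comb ξ (K.n 2) = b 0 * K.n 1 - b 1 * K.n 0 at e2
    rw [h3, hR, e2, K.x_zero, K.x_one]
    linear_combination -K.n 0 * hb0 - K.n 1 * hb1

end FlatKSVF

end RayRing
end KerrSchild

namespace KerrSchild

noncomputable section

/-! ### The ring of smooth functions on a coordinate domain -/

/-- The ring of the functions on `U` that are smooth. -/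
def SmoothRing (U : Set Coord) : Subalgebra ℝ (U → ℝ) where
  carrier := {f | ∃ F : Coord → ℝ, ContDiffOn ℝ ∞ F U ∧ ∀ p : U, F p = f p}
  mul_mem' := by
    rintro f g ⟨F, hF, hf⟩ ⟨G, hG, hg⟩
    exact ⟨fun p => F p * G p, hF.mul hG, fun p => by simp [hf, hg]⟩
  add_mem' := by
    rintro f g ⟨F, hF, hf⟩ ⟨G, hG, hg⟩
    exact ⟨fun p => F p + G p, hF.add hG, fun p => by simp [hf, hg]⟩
  algebraMap_mem' := fun c => ⟨fun _ => c, contDiffOn_const, fun _ => rfl⟩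

namespace SmoothRing

variable {U : Set Coord}

/-- The element of the ring given by a smooth function. -/
def mk (F : Coord → ℝ) (hF : ContDiffOn ℝ ∞ F U) : SmoothRing U :=
  ⟨fun p => F p, F, hF, fun _ => rfl⟩

/-- A smooth representative. -/
def rep (f : SmoothRing U) : Coord → ℝ := f.2.choose

theorem contDiffOn_rep (f : SmoothRing U) : ContDiffOn ℝ ∞ (rep f) U := f.2.choose_spec.1

theorem rep_apply (f : SmoothRing U) (p : U) : (rep f) p = f.1 p := f.2.choose_spec.2 p

theorem ext {f g : SmoothRing U} (h : ∀ p : U, f.1 p = g.1 p) : f = g := Subtype.ext (funext h)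

theorem contDiffOn_pd (hU : IsOpen U) {F : Coord → ℝ} (hF : ContDiffOn ℝ ∞ F U) (i : Fin 4) :
    ContDiffOn ℝ ∞ (pd i F) U :=
  (hF.fderiv_of_isOpen hU (m := ∞) (by simp)).clm_apply contDiffOn_const

theorem pd_congr (hU : IsOpen U) {F G : Coord → ℝ} (h : Set.EqOn F G U) (i : Fin 4) {p : Coord}
    (hp : p ∈ U) : pd i F p = pd i G p := by
  rw [pd, pd, (h.eventuallyEq_of_mem (hU.mem_nhds hp)).fderiv_eq]

theorem differentiableAt (hU : IsOpen U) {F : Coord → ℝ} (hF : ContDiffOn ℝ ∞ F U) {p : Coord}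
    (hp : p ∈ U) : DifferentiableAt ℝ F p :=
  (hF.contDiffAt (hU.mem_nhds hp)).differentiableAt (by simp)

theorem pd_add (i : Fin 4) {F G : Coord → ℝ} {p : Coord} (hF : DifferentiableAt ℝ F p)
    (hG : DifferentiableAt ℝ G p) : pd i (fun q => F q + G q) p = pd i F p + pd i G p := by
  simp [pd, fderiv_fun_add hF hG]

theorem pd_mul (i : Fin 4) {F G : Coord → ℝ} {p : Coord} (hF : DifferentiableAt ℝ F p)
    (hG : DifferentiableAt ℝ G p) :
    pd i (fun q => F q * G q) p = F p * pd i G p + G p * pd i F p := by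
  simp [pd, fderiv_fun_mul hF hG]

theorem pd_const (i : Fin 4) (c : ℝ) (p : Coord) : pd i (fun _ => c) p = 0 := by
  simp [pd]

theorem pd_coord (i j : Fin 4) (p : Coord) : pd i (fun q => q j) p = if i = j then 1 else 0 := by
  have : fderiv ℝ (fun q : Coord => q j) p = ContinuousLinearMap.proj j :=
    (ContinuousLinearMap.proj (R := ℝ) (φ := fun _ : Fin 4 => ℝ) j).fderiv
  simp [pd, this, Pi.single_apply, eq_comm]

theorem pd_comm (hU : IsOpen U) {F : Coord → ℝ} (hF : ContDiffOn ℝ ∞ F U) (i j : Fin 4) {p : Coord}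
    (hp : p ∈ U) : pd i (pd j F) p = pd j (pd i F) p := by
  have hc := hF.contDiffAt (hU.mem_nhds hp)
  have hs : IsSymmSndFDerivAt ℝ F p := hc.isSymmSndFDerivAt (by simp; exact WithTop.coe_le_coe.2 (le_top : (2 : ℕ∞) ≤ ⊤))
  have hd : DifferentiableAt ℝ (fderiv ℝ F) p :=
    (hc.fderiv_right (m := ∞) (by simp)).differentiableAt (by simp)
  have key : ∀ k l : Fin 4, pd k (pd l F) p
      = fderiv ℝ (fderiv ℝ F) p (Pi.single k 1) (Pi.single l 1) := fun k l => by
    rw [pd, show pd l F = fun q => fderiv ℝ F q (Pi.single l 1) from rfl, fderiv_clm_apply hd (differentiableAt_const _)]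
    simp
  rw [key, key, hs]

/-- The partial derivatives as derivations of the ring of smooth functions. -/
def partialDeriv (hU : IsOpen U) (i : Fin 4) : Derivation ℝ (SmoothRing U) (SmoothRing U) :=
  Derivation.mk'
    -- The extension `rep f` is an arbitrary choice, but on the open set `U` its derivatives depend
    -- only on `f`; each law below changes representatives by `pd_congr`.
    { toFun := fun f => mk (pd i (rep f)) (contDiffOn_pd hU (contDiffOn_rep f) i)
      map_add' := fun f g => ext fun p => by
        change pd i (rep (f + g)) p = pd i (rep f) p + pd i (rep g) p
        rw [← pd_add i (differentiableAt hU (contDiffOn_rep f) p.2)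
          (differentiableAt hU (contDiffOn_rep g) p.2)]
        refine pd_congr hU (fun q hq => ?_) i p.2
        rw [rep_apply _ ⟨q, hq⟩, rep_apply f ⟨q, hq⟩, rep_apply g ⟨q, hq⟩]
        rfl
      map_smul' := fun c f => ext fun p => by
        change pd i (rep (c • f)) p = c * pd i (rep f) p
        have h := pd_mul i (F := fun _ => c) (differentiableAt_const c)
          (differentiableAt hU (contDiffOn_rep f) p.2)
        rw [pd_const, mul_zero, add_zero] at h
        rw [← h]
        refine pd_congr hU (fun q hq => ?_) i p.2
        rw [rep_apply _ ⟨q, hq⟩, rep_apply f ⟨q, hq⟩]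
        rfl }
    fun f g => ext fun p => by
      change pd i (rep (f * g)) p = f.1 p * pd i (rep g) p + g.1 p * pd i (rep f) p
      rw [← rep_apply f, ← rep_apply g, ← pd_mul i (differentiableAt hU (contDiffOn_rep f) p.2)
        (differentiableAt hU (contDiffOn_rep g) p.2)]
      refine pd_congr hU (fun q hq => ?_) i p.2
      rw [rep_apply _ ⟨q, hq⟩, rep_apply f ⟨q, hq⟩, rep_apply g ⟨q, hq⟩]
      rfl

theorem partialDeriv_mk (hU : IsOpen U) (i : Fin 4) (F : Coord → ℝ) (hF : ContDiffOn ℝ ∞ F U) :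
    partialDeriv hU i (mk F hF) = mk (pd i F) (contDiffOn_pd hU hF i) :=
  ext fun p => pd_congr hU (fun q hq => rep_apply (mk F hF) ⟨q, hq⟩) i p.2

theorem mk_rep (f : SmoothRing U) : mk (rep f) (contDiffOn_rep f) = f := ext (rep_apply f)

theorem partialDeriv_comm (hU : IsOpen U) (i j : Fin 4) (f : SmoothRing U) :
    partialDeriv hU i (partialDeriv hU j f) = partialDeriv hU j (partialDeriv hU i f) := by
  rw [← mk_rep f]
  simp only [partialDeriv_mk]
  exact ext fun p => pd_comm hU (contDiffOn_rep f) i j p.2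

theorem exists_const (hU : IsOpen U) (hc : IsPreconnected U) {f : SmoothRing U}
    (h : ∀ i, partialDeriv hU i f = 0) : ∃ c : ℝ, ∀ p : U, f.1 p = c := by
  have hd : ∀ p ∈ U, fderiv ℝ (rep f) p = 0 := fun p hp => by
    refine ContinuousLinearMap.coe_injective (LinearMap.pi_ext' fun i => LinearMap.ext_ring ?_)
    exact congrFun (congrArg Subtype.val (h i)) ⟨p, hp⟩
  obtain ⟨c, hc⟩ := hU.exists_is_const_of_fderiv_eq_zero hc
    (fun p hp => (differentiableAt hU (contDiffOn_rep f) hp).differentiableWithinAt) hd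
  exact ⟨c, fun p => by rw [← rep_apply, hc p p.2]⟩

end SmoothRing

end

end KerrSchild

namespace KerrSchild

noncomputable section

/-! ### The Kerr-Newman principal null congruences -/

theorem contDiff_coord (i : Fin 4) : ContDiff ℝ ∞ (fun p : Coord => p i) :=
  contDiff_apply ℝ ℝ i

theorem contDiffOn_radius (a : ℝ) : ContDiffOn ℝ ∞ (radius a) (domain a) := by
  have hx := contDiff_coord 1
  have hy := contDiff_coord 2
  have hz := contDiff_coord 3
  have hq : ContDiff ℝ ∞ fun p : Coord => p 1 ^ 2 + p 2 ^ 2 + p 3 ^ 2 - a ^ 2 :=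
    (((hx.pow 2).add (hy.pow 2)).add (hz.pow 2)).sub contDiff_const
  have hd : ContDiff ℝ ∞ fun p : Coord =>
      (p 1 ^ 2 + p 2 ^ 2 + p 3 ^ 2 - a ^ 2) ^ 2 + 4 * a ^ 2 * p 3 ^ 2 :=
    (hq.pow 2).add (contDiff_const.mul (hz.pow 2))
  have hs : ContDiffOn ℝ ∞ (fun p : Coord =>
      √((p 1 ^ 2 + p 2 ^ 2 + p 3 ^ 2 - a ^ 2) ^ 2 + 4 * a ^ 2 * p 3 ^ 2)) (domain a) := by
    refine hd.contDiffOn.sqrt fun p hp h => hp ?_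
    have h1 : p 1 ^ 2 + p 2 ^ 2 + p 3 ^ 2 - a ^ 2 = 0 := by nlinarith [sq_nonneg (a * p 3)]
    have h2 : a * p 3 = 0 := by nlinarith
    rcases mul_eq_zero.1 h2 with h | h
    · subst h
      exact ⟨by nlinarith [sq_nonneg (p 1), sq_nonneg (p 2)], by nlinarith [sq_nonneg (p 3)]⟩
    · exact ⟨h, by rw [h] at h1; linarith⟩
  exact ((hq.contDiffOn.add hs).div_const 2).sqrt
    fun p hp => (Real.sqrt_pos.1 (radius_pos hp)).ne'

theorem units_sq (σ : ℤˣ) : ((σ : ℤ) : ℝ) * ((σ : ℤ) : ℝ) = 1 := by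
  rcases Int.units_eq_one_or σ with rfl | rfl <;> simp

theorem branch_ne_zero {ε : ℤˣ} {a : ℝ} {p : Coord} (hp : p ∈ domain a) : branch ε a p ≠ 0 :=
  mul_ne_zero (fun h => by simpa [h] using units_sq ε) (radius_pos hp).ne'

theorem branch_eq (ε : ℤˣ) (a : ℝ) (p : Coord) :
    branch ε a p ^ 2 * (p 1 ^ 2 + p 2 ^ 2 + p 3 ^ 2) + a ^ 2 * p 3 ^ 2
      = branch ε a p ^ 2 * (branch ε a p ^ 2 + a ^ 2) := by
  have h : branch ε a p ^ 2 = radius a p ^ 2 := by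
    rw [branch, mul_pow, sq ((ε : ℤ) : ℝ), units_sq, one_mul]
  rw [h, radius_eq]

theorem contDiffOn_branch (ε : ℤˣ) (a : ℝ) : ContDiffOn ℝ ∞ (branch ε a) (domain a) :=
  contDiffOn_const.mul (contDiffOn_radius a)

/-- The spatial direction of the null congruence. -/
def dir (ε : ℤˣ) (a : ℝ) (p : Coord) : Fin 3 → ℝ :=
  ![(branch ε a p * p 1 + a * p 2) / (branch ε a p ^ 2 + a ^ 2),
    (branch ε a p * p 2 - a * p 1) / (branch ε a p ^ 2 + a ^ 2), p 3 / branch ε a p]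

theorem pnd_zero (σ ε : ℤˣ) (a : ℝ) (p : Coord) : pnd σ ε a p 0 = 1 / √2 * ((σ : ℤ) : ℝ) := rfl

section dir

variable {ε : ℤˣ} {a : ℝ} {p : Coord} (hp : p ∈ domain a)
include hp

theorem branch_sq_add_pos : 0 < branch ε a p ^ 2 + a ^ 2 := by
  have := sq_pos_of_ne_zero (branch_ne_zero (ε := ε) hp)
  positivity

theorem coord_one_eq : p 1 = branch ε a p * dir ε a p 0 - a * dir ε a p 1 := by
  have := (branch_sq_add_pos (ε := ε) hp).ne'
  simp only [dir, Matrix.cons_val_zero, Matrix.cons_val_one]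
  field_simp
  ring

theorem coord_two_eq : p 2 = branch ε a p * dir ε a p 1 + a * dir ε a p 0 := by
  have := (branch_sq_add_pos (ε := ε) hp).ne'
  simp only [dir, Matrix.cons_val_zero, Matrix.cons_val_one]
  field_simp
  ring

theorem coord_three_eq : p 3 = branch ε a p * dir ε a p 2 := by
  have := branch_ne_zero (ε := ε) hp
  simp [dir]
  field_simp

theorem norm_dir : dir ε a p 0 ^ 2 + dir ε a p 1 ^ 2 + dir ε a p 2 ^ 2 = 1 := by
  have h1 := (branch_sq_add_pos (ε := ε) hp).ne'
  have h2 := branch_ne_zero (ε := ε) hp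
  have h3 := branch_eq ε a p
  simp [dir]
  field_simp
  linear_combination (branch ε a p ^ 2 + a ^ 2) * h3

end dir

theorem contDiffOn_dir (ε : ℤˣ) (a : ℝ) (i : Fin 3) :
    ContDiffOn ℝ ∞ (fun p => dir ε a p i) (domain a) := by
  have hr := contDiffOn_branch ε a
  have hx := (contDiff_coord 1).contDiffOn (s := domain a)
  have hy := (contDiff_coord 2).contDiffOn (s := domain a)
  have hz := (contDiff_coord 3).contDiffOn (s := domain a)
  have hd : ContDiffOn ℝ ∞ (fun p => branch ε a p ^ 2 + a ^ 2) (domain a) :=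
    (hr.pow 2).add contDiffOn_const
  fin_cases i
  · exact ((hr.mul hx).add (contDiffOn_const.mul hy)).div hd fun p hp => (branch_sq_add_pos hp).ne'
  · exact ((hr.mul hy).sub (contDiffOn_const.mul hx)).div hd fun p hp => (branch_sq_add_pos hp).ne'
  · exact hz.div hr fun p hp => branch_ne_zero hp

/-- The ring of smooth functions on `U` with the null congruence. -/
def rayRing (σ ε : ℤˣ) {a : ℝ} {U : Set Coord} (hUo : IsOpen U) (hU : U ⊆ domain a) :
    RayRing (SmoothRing U) where
  D := SmoothRing.partialDeriv hUo
  x := fun i => SmoothRing.mk (fun p => p i.succ) (contDiff_coord _).contDiffOn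
  α := algebraMap ℝ _ a
  σ := algebraMap ℝ _ ((σ : ℤ) : ℝ)
  n := fun i => SmoothRing.mk (fun p => dir ε a p i) ((contDiffOn_dir ε a i).mono hU)
  r := SmoothRing.mk (branch ε a) ((contDiffOn_branch ε a).mono hU)
  r_inv := SmoothRing.mk (fun p => (branch ε a p)⁻¹)
    (((contDiffOn_branch ε a).mono hU).inv fun p hp => branch_ne_zero (hU hp))
  s := SmoothRing.mk (fun p => (branch ε a p ^ 2 + a ^ 2 * dir ε a p 2 ^ 2)⁻¹) (by
    refine ContDiffOn.inv ?_ fun p hp => ?_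
    · exact (((contDiffOn_branch ε a).mono hU).pow 2).add
        (contDiffOn_const.mul (((contDiffOn_dir ε a 2).mono hU).pow 2))
    · have := sq_pos_of_ne_zero (branch_ne_zero (ε := ε) (hU hp))
      positivity)
  D_comm := SmoothRing.partialDeriv_comm hUo
  D_x := fun i j => by
    rw [SmoothRing.partialDeriv_mk]
    refine SmoothRing.ext fun p => ?_
    change pd i (fun q => q j.succ) p = _
    rw [SmoothRing.pd_coord]
    split_ifs <;> rfl
  D_α := fun i => Derivation.map_algebraMap _ _
  D_σ := fun i => Derivation.map_algebraMap _ _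
  σ_sq := by rw [← map_mul, units_sq, map_one]
  norm_n := SmoothRing.ext fun p => norm_dir (hU p.2)
  x_zero := SmoothRing.ext fun p => coord_one_eq (hU p.2)
  x_one := SmoothRing.ext fun p => coord_two_eq (hU p.2)
  x_two := SmoothRing.ext fun p => coord_three_eq (hU p.2)
  mul_r_inv := SmoothRing.ext fun p => mul_inv_cancel₀ (branch_ne_zero (hU p.2))
  mul_s := SmoothRing.ext fun p => by
    have := sq_pos_of_ne_zero (branch_ne_zero (ε := ε) (hU p.2))
    refine mul_inv_cancel₀ (a := branch ε a p ^ 2 + a ^ 2 * dir ε a p 2 ^ 2) ?_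
    positivity

end

end KerrSchild

/-! ### From the tensor equations on `U` to equations in the ring -/

namespace KerrSchild

namespace RayRing

variable {A : Type*} [CommRing A] [Algebra ℝ A] (K : RayRing A)

/-- A rotation whose axis is compatible with the twist preserves the congruence. -/
theorem comb_rotation {ξ : Fin 4 → A} {b : Fin 3 → A} (hb0 : K.α * b 0 = 0) (hb1 : K.α * b 1 = 0)
    (h1 : ξ 1 = b 1 * K.x 2 - b 2 * K.x 1) (h2 : ξ 2 = b 2 * K.x 0 - b 0 * K.x 2)
    (h3 : ξ 3 = b 0 * K.x 1 - b 1 * K.x 0) :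
    K.comb ξ K.r = 0 ∧ K.comb ξ (K.n 0) = b 1 * K.n 2 - b 2 * K.n 1 ∧
      K.comb ξ (K.n 1) = b 2 * K.n 0 - b 0 * K.n 2 ∧
      K.comb ξ (K.n 2) = b 0 * K.n 1 - b 1 * K.n 0 := by
  refine K.comb_eq ?_ ?_ ?_ ?_
  · rw [h1, K.x_one, K.x_two]; linear_combination -K.n 2 * hb0
  · rw [h2, K.x_zero, K.x_two]; linear_combination -K.n 2 * hb1
  · rw [h3, K.x_zero, K.x_one]; linear_combination K.n 0 * hb0 + K.n 1 * hb1
  · ring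

theorem flatKSVF_of_rotation {ξ : Fin 4 → A} {b : Fin 3 → A} (h0 : ∀ i, K.D i (ξ 0) = 0)
    (hb : ∀ i j, K.D i (b j) = 0) (hb0 : K.α * b 0 = 0) (hb1 : K.α * b 1 = 0)
    (h1 : ξ 1 = b 1 * K.x 2 - b 2 * K.x 1) (h2 : ξ 2 = b 2 * K.x 0 - b 0 * K.x 2)
    (h3 : ξ 3 = b 0 * K.x 1 - b 1 * K.x 0) : K.FlatKSVF ξ 0 0 := by
  obtain ⟨-, g0, g1, g2⟩ := K.comb_rotation hb0 hb1 h1 h2 h3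
  constructor
  · intro i j
    fin_cases i <;> fin_cases j <;>
      simp [minkowski, h0, h1, h2, h3, hb, K.D_x, Fin.ext_iff]
  · intro i
    fin_cases i <;>
      simp [lForm, comb_σ, h0, g0, g1, g2, h1, h2, h3, hb, K.D_x, Fin.ext_iff] <;> ring

end RayRing

noncomputable section

open SmoothRing

variable {σ ε : ℤˣ} {a : ℝ} {U : Set Coord} (hUo : IsOpen U) (hU : U ⊆ domain a)

theorem one_div_sqrt_two_sq : (1 / √2 : ℝ) * (1 / √2) = 1 / 2 := by
  rw [div_mul_div_comm, Real.mul_self_sqrt (by norm_num), one_mul]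

theorem pnd_eq (p : U) (i : Fin 4) :
    pnd σ ε a p i = 1 / √2 * ((rayRing σ ε hUo hU).lForm i).1 p := by
  fin_cases i <;> rfl

theorem contDiffOn_pnd (i : Fin 4) : ContDiffOn ℝ ∞ (fun p => pnd σ ε a p i) (domain a) := by
  fin_cases i
  · exact contDiffOn_const (c := 1 / √2 * ((σ : ℤ) : ℝ))
  · exact contDiffOn_const.mul (contDiffOn_dir ε a 0)
  · exact contDiffOn_const.mul (contDiffOn_dir ε a 1)
  · exact contDiffOn_const.mul (contDiffOn_dir ε a 2)

theorem pd_pnd (p : U) (k i : Fin 4) : pd k (fun q => pnd σ ε a q i) p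
    = 1 / √2 * ((rayRing σ ε hUo hU).D k ((rayRing σ ε hUo hU).lForm i)).1 p := by
  have hl := ((contDiffOn_rep ((rayRing σ ε hUo hU).lForm i)))
  rw [pd_congr hUo (G := fun q => 1 / √2 * rep ((rayRing σ ε hUo hU).lForm i) q)
      (fun q hq => by rw [pnd_eq hUo hU ⟨q, hq⟩, ← rep_apply]) k p.2,
    pd_mul k (F := fun _ => 1 / √2) (differentiableAt_const _) (differentiableAt hUo hl p.2), pd_const, mul_zero, add_zero]
  rfl

theorem isNullCovector_pnd (H : Coord → ℝ) {p : Coord} (hp : p ∈ domain a) :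
    IsNullCovector (ksMetric H (pnd σ ε a) p) (pnd σ ε a p) := by
  have hn := norm_dir (ε := ε) hp
  have hσ := units_sq σ
  have h2 : (1 / √2 : ℝ) ≠ 0 := by positivity
  refine ⟨fun h => ?_, ![-pnd σ ε a p 0, pnd σ ε a p 1, pnd σ ε a p 2, pnd σ ε a p 3], ?_⟩
  · have := congrFun h 0
    rw [pnd_zero] at this
    rcases mul_eq_zero.1 this with h | h
    · exact h2 h
    · simp [h] at hσ
  · have hl : pnd σ ε a p ⬝ᵥ ![-pnd σ ε a p 0, pnd σ ε a p 1, pnd σ ε a p 2, pnd σ ε a p 3] = 0 := by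
      have h1 : pnd σ ε a p 1 = 1 / √2 * dir ε a p 0 := rfl
      have h2 : pnd σ ε a p 2 = 1 / √2 * dir ε a p 1 := rfl
      have h3 : pnd σ ε a p 3 = 1 / √2 * dir ε a p 2 := rfl
      simp only [dotProduct, Fin.sum_univ_four]
      simp [h1, h2, h3, pnd_zero]
      linear_combination (√2)⁻¹ ^ 2 * (hn - hσ)
    refine ⟨?_, hl⟩
    rw [ksMetric, Matrix.add_mulVec, Matrix.smul_mulVec, Matrix.vecMulVec_mulVec, hl]
    ext i
    fin_cases i <;> simp [eta, Matrix.mulVec_diagonal]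

section

variable {ξ : Coord → Coord} (hξ : ∀ i, ContDiffOn ℝ ∞ (fun p => ξ p i) U)

theorem lieForm_pnd (p : U) (i : Fin 4) : lieForm ξ (pnd σ ε a) p i = 1 / √2 *
    ((rayRing σ ε hUo hU).comb (fun k => mk _ (hξ k)) ((rayRing σ ε hUo hU).lForm i)
      + ((rayRing σ ε hUo hU).lForm 0 * (rayRing σ ε hUo hU).D i (mk _ (hξ 0))
        + (rayRing σ ε hUo hU).lForm 1 * (rayRing σ ε hUo hU).D i (mk _ (hξ 1))
        + (rayRing σ ε hUo hU).lForm 2 * (rayRing σ ε hUo hU).D i (mk _ (hξ 2))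
        + (rayRing σ ε hUo hU).lForm 3 * (rayRing σ ε hUo hU).D i (mk _ (hξ 3)))).1 p := by
  have hD : ∀ k, ((rayRing σ ε hUo hU).D i (mk _ (hξ k))).1 p = pd i (fun q => ξ q k) p :=
    fun k => congrArg (fun f => f.1 p) (partialDeriv_mk hUo i _ (hξ k))
  simp only [lieForm, Fin.sum_univ_four, pd_pnd hUo hU, RayRing.comb_apply]
  simp only [Subalgebra.coe_add, Subalgebra.coe_mul, Pi.add_apply, Pi.mul_apply, hD, pnd_eq hUo hU]
  simp only [mk]
  ring

include hUo hU in
theorem pd_ksMetric {H : Coord → ℝ} (hH : ContDiffOn ℝ ∞ H U) (p : U) (k i j : Fin 4) :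
    pd k (fun q => ksMetric H (pnd σ ε a) q i j) p
      = 2 * (pd k H p * (pnd σ ε a p i * pnd σ ε a p j)
        + H p * (pd k (fun q => pnd σ ε a q i) p * pnd σ ε a p j
          + pnd σ ε a p i * pd k (fun q => pnd σ ε a q j) p)) := by
  have hl : ∀ i, DifferentiableAt ℝ (fun q => pnd σ ε a q i) p := fun i =>
    differentiableAt hUo ((contDiffOn_pnd i).mono hU) p.2
  have hd := differentiableAt hUo hH p.2
  have h : (fun q => ksMetric H (pnd σ ε a) q i j)
      = fun q => eta i j + 2 * (H q * (pnd σ ε a q i * pnd σ ε a q j)) := by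
    ext q
    simp only [ksMetric, Matrix.add_apply, Matrix.smul_apply, Matrix.vecMulVec_apply, smul_eq_mul]
    ring
  have hll : DifferentiableAt ℝ (fun q => pnd σ ε a q i * pnd σ ε a q j) p := (hl i).mul (hl j)
  have hHll : DifferentiableAt ℝ (fun q => H q * (pnd σ ε a q i * pnd σ ε a q j)) p := hd.mul hll
  rw [h, pd_add k (differentiableAt_const _) (hHll.const_mul 2), pd_const,
    pd_mul k (F := fun _ => 2) (differentiableAt_const _) hHll, pd_const,
    pd_mul k hd hll, pd_mul k (hl i) (hl j)]
  ring

theorem sum_eta_mul (v : Fin 4 → ℝ) (j : Fin 4) :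
    ∑ k, eta k j * v k = RayRing.minkowski j * v j := by
  simp only [Fin.sum_univ_four]
  fin_cases j <;> simp [eta, RayRing.minkowski]

theorem sum_eta_mul' (v : Fin 4 → ℝ) (i : Fin 4) :
    ∑ k, eta i k * v k = RayRing.minkowski i * v i := by
  simp only [Fin.sum_univ_four]
  fin_cases i <;> simp [eta, RayRing.minkowski]

theorem coe_minkowski (p : U) (i : Fin 4) :
    (RayRing.minkowski i : SmoothRing U).1 p = RayRing.minkowski i := by
  fin_cases i <;> simp [RayRing.minkowski]

/-- Leibniz rule for `η + 2 H ℓ ⊗ ℓ`. When `L_ξ ℓ = m ℓ`, all summands but the flat one are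
multiples of `ℓ ⊗ ℓ`, so `H` is absorbed into the gauge. -/
theorem lieMetric_pnd {H : Coord → ℝ} (hH : ContDiffOn ℝ ∞ H U) (p : U) (i j : Fin 4) :
    lieMetric ξ (ksMetric H (pnd σ ε a)) p i j
      = (RayRing.minkowski j * (rayRing σ ε hUo hU).D i (mk _ (hξ j))
          + RayRing.minkowski i * (rayRing σ ε hUo hU).D j (mk _ (hξ i))).1 p
        + 2 * ((rayRing σ ε hUo hU).comb (fun k => mk _ (hξ k)) (mk H hH)).1 p
          * (pnd σ ε a p i * pnd σ ε a p j)
        + 2 * H p * (lieForm ξ (pnd σ ε a) p i * pnd σ ε a p j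
          + pnd σ ε a p i * lieForm ξ (pnd σ ε a) p j) := by
  have hD : ∀ i k, ((rayRing σ ε hUo hU).D i (mk _ (hξ k))).1 p = pd i (fun q => ξ q k) p :=
    fun i k => congrArg (fun f => f.1 p) (partialDeriv_mk hUo i _ (hξ k))
  have hDH : ∀ i, ((rayRing σ ε hUo hU).D i (mk H hH)).1 p = pd i H p :=
    fun i => congrArg (fun f => f.1 p) (partialDeriv_mk hUo i _ hH)
  have e1 := sum_eta_mul (fun k => pd i (fun q => ξ q k) p) j
  have e2 := sum_eta_mul' (fun k => pd j (fun q => ξ q k) p) i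
  have hg : ∀ i j, ksMetric H (pnd σ ε a) p i j
      = eta i j + 2 * H p * (pnd σ ε a p i * pnd σ ε a p j) := fun i j => by
    simp [ksMetric, Matrix.vecMulVec_apply]
  simp only [lieMetric, lieForm, Matrix.of_apply, pd_ksMetric hUo hU hH, hg, RayRing.comb_apply]
  simp only [Subalgebra.coe_add, Subalgebra.coe_mul, Pi.add_apply, Pi.mul_apply, hD, hDH,
    coe_minkowski]
  simp only [Fin.sum_univ_four] at e1 e2 ⊢
  simp only [mk]
  linear_combination e1 + e2

/-- The equations of Kerr-Schild vector fields in the ring of smooth functions. -/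
theorem isKSVF_iff {H h m : Coord → ℝ} (hH : ContDiffOn ℝ ∞ H U) (hh : ContDiffOn ℝ ∞ h U)
    (hm : ContDiffOn ℝ ∞ m U) :
    IsKSVF U (ksMetric H (pnd σ ε a)) (pnd σ ε a) ξ h m ↔
      (rayRing σ ε hUo hU).FlatKSVF (fun k => mk _ (hξ k))
        (mk h hh - (rayRing σ ε hUo hU).comb (fun k => mk _ (hξ k)) (mk H hH)
          - 2 * mk H hH * mk m hm) (mk m hm) := by
  have h3 : (1 / √2 : ℝ) ≠ 0 := by positivity
  have hf : ∀ p : U, (∀ i, lieForm ξ (pnd σ ε a) p i = m p * pnd σ ε a p i) → ∀ i j,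
      (lieMetric ξ (ksMetric H (pnd σ ε a)) p i j = 2 * h p * (pnd σ ε a p i * pnd σ ε a p j) ↔
      (RayRing.minkowski j * (rayRing σ ε hUo hU).D i (mk _ (hξ j))
          + RayRing.minkowski i * (rayRing σ ε hUo hU).D j (mk _ (hξ i))).1 p
        = ((mk h hh - (rayRing σ ε hUo hU).comb (fun k => mk _ (hξ k)) (mk H hH)
          - 2 * mk H hH * mk m hm) * (rayRing σ ε hUo hU).lForm i
          * (rayRing σ ε hUo hU).lForm j).1 p) := by
    intro p hp i j
    rw [lieMetric_pnd hUo hU hξ hH, hp, hp, pnd_eq hUo hU, pnd_eq hUo hU]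
    simp only [Subalgebra.coe_add, Subalgebra.coe_sub, Subalgebra.coe_mul, Pi.add_apply,
      Pi.sub_apply, Pi.mul_apply]
    have c2 : (2 : SmoothRing U).1 p = 2 := rfl
    have cH : (mk H hH).1 p = H p := rfl
    have ch : (mk h hh).1 p = h p := rfl
    have cm : (mk m hm).1 p = m p := rfl
    rw [c2, cH, ch, cm]
    -- Since `ℓ` is `lForm` divided by `√2`, the tensor `2 ℓ ⊗ ℓ` is the square of `lForm`; this
    -- accounts for the factors of 2.
    have h2 := one_div_sqrt_two_sq
    constructor <;> intro e
    · linear_combination e - (2 * ((rayRing σ ε hUo hU).comb (fun k => mk _ (hξ k)) (mk H hH)).1 p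
        + 4 * H p * m p - 2 * h p) * ((rayRing σ ε hUo hU).lForm i).1 p
        * ((rayRing σ ε hUo hU).lForm j).1 p * h2
    · linear_combination e + (2 * ((rayRing σ ε hUo hU).comb (fun k => mk _ (hξ k)) (mk H hH)).1 p
        + 4 * H p * m p - 2 * h p) * ((rayRing σ ε hUo hU).lForm i).1 p
        * ((rayRing σ ε hUo hU).lForm j).1 p * h2
  constructor
  · intro hK
    refine ⟨fun i j => SmoothRing.ext fun p => ?_, fun i => SmoothRing.ext fun p => ?_⟩
    · refine (hf p (fun i => congrFun (hK.lie_form p p.2) i) i j).1 ?_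
      exact congrFun (congrFun (hK.lie_metric p p.2) i) j
    · have := congrFun (hK.lie_form p p.2) i
      rw [lieForm_pnd hUo hU hξ p, Pi.smul_apply, pnd_eq hUo hU, smul_eq_mul, mul_left_comm] at this
      exact mul_left_cancel₀ h3 this
  · intro hF
    have hform : ∀ p : U, ∀ i, lieForm ξ (pnd σ ε a) p i = m p * pnd σ ε a p i := fun p i => by
      rw [lieForm_pnd hUo hU hξ p, hF.form, pnd_eq hUo hU, mul_left_comm]
      rfl
    refine ⟨fun p hp => isNullCovector_pnd H (hU hp), contDiffOn_pi.2 hξ, hh, hm,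
      fun p hp => Matrix.ext fun i j => ?_, fun p hp => funext fun i => hform ⟨p, hp⟩ i⟩
    exact (hf ⟨p, hp⟩ (hform ⟨p, hp⟩) i j).2 (congrArg (fun f => f.1 ⟨p, hp⟩) (hF.metric i j))

end

end

end KerrSchild

namespace KerrSchild

noncomputable section

open SmoothRing

/-! ### The Kerr-Schild vector fields -/

/-- The sum of `c ∂_t` and the infinitesimal rotation with axis `b`. -/
def rotField (c : ℝ) (b : Fin 3 → ℝ) : Coord → Coord := fun p =>
  ![c, b 1 * p 3 - b 2 * p 2, b 2 * p 1 - b 0 * p 3, b 0 * p 2 - b 1 * p 1]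

theorem contDiff_rotField (c : ℝ) (b : Fin 3 → ℝ) (i : Fin 4) :
    ContDiff ℝ ∞ (fun p => rotField c b p i) := by
  have h1 := contDiff_coord 1
  have h2 := contDiff_coord 2
  have h3 := contDiff_coord 3
  fin_cases i
  · exact contDiff_const (c := c)
  · exact (contDiff_const.mul h3).sub (contDiff_const.mul h2)
  · exact (contDiff_const.mul h1).sub (contDiff_const.mul h3)
  · exact (contDiff_const.mul h2).sub (contDiff_const.mul h1)

theorem sum_mul_pd (H : Coord → ℝ) (p v : Coord) :
    v 0 * pd 0 H p + v 1 * pd 1 H p + v 2 * pd 2 H p + v 3 * pd 3 H p = fderiv ℝ H p v := by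
  have hv : v = ∑ i, v i • (Pi.single i 1 : Coord) := by
    conv_lhs => rw [← Finset.univ_sum_single v]
    simp [← Pi.single_smul]
  conv_rhs => rw [hv]
  simp [pd, Fin.sum_univ_four]

section

variable {σ ε : ℤˣ} {a : ℝ} {U : Set Coord} (hUo : IsOpen U) (hU : U ⊆ domain a)
  {H : Coord → ℝ} (hH : ContDiffOn ℝ ∞ H U)
  (hinv : ∀ (c : ℝ) (b : Fin 3 → ℝ), a * b 0 = 0 → a * b 1 = 0 →
    ∀ p ∈ U, fderiv ℝ H p (rotField c b p) = 0)
include hUo hU hH hinv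

theorem exists_rotField_of_isKSVF (hUc : IsPreconnected U) {ξ : Coord → Coord} {h m : Coord → ℝ}
    (hK : IsKSVF U (ksMetric H (pnd σ ε a)) (pnd σ ε a) ξ h m) :
    (∃ (c : ℝ) (b : Fin 3 → ℝ), a * b 0 = 0 ∧ a * b 1 = 0 ∧ Set.EqOn ξ (rotField c b) U) ∧
      ∀ p ∈ U, h p = 0 ∧ m p = 0 := by
  -- A point is needed to turn the ring identity `α * b j = 0` into one between real numbers.
  rcases U.eq_empty_or_nonempty with rfl | ⟨p₀, hp₀⟩
  · exact ⟨⟨0, 0, by simp⟩, by simp⟩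
  have hξ := contDiffOn_pi.1 hK.smooth_field
  have hF := (isKSVF_iff hUo hU hξ hH hK.smooth_h hK.smooth_m).1 hK
  obtain ⟨hm, hh, h0, b, hb, hb0, hb1, h1, h2, h3⟩ := hF.exists_rotation
  obtain ⟨c, hc⟩ := exists_const hUo hUc h0
  choose b' hb' using fun j => exists_const hUo hUc fun i => hb i j
  have hab : a * b' 0 = 0 ∧ a * b' 1 = 0 := by
    rw [← hb' 0 ⟨p₀, hp₀⟩, ← hb' 1 ⟨p₀, hp₀⟩]
    exact ⟨congrArg (fun f => f.1 ⟨p₀, hp₀⟩) hb0, congrArg (fun f => f.1 ⟨p₀, hp₀⟩) hb1⟩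
  have hX : Set.EqOn ξ (rotField c b') U := by
    intro p hp
    have e1 := congrArg (fun f => f.1 ⟨p, hp⟩) h1
    have e2 := congrArg (fun f => f.1 ⟨p, hp⟩) h2
    have e3 := congrArg (fun f => f.1 ⟨p, hp⟩) h3
    simp only [Subalgebra.coe_sub, Subalgebra.coe_mul, Pi.sub_apply, Pi.mul_apply, hb'] at e1 e2 e3
    ext i
    fin_cases i
    · exact hc ⟨p, hp⟩
    · exact e1
    · exact e2
    · exact e3
  refine ⟨⟨c, b', hab.1, hab.2, hX⟩, fun p hp => ?_⟩
  have hm' : m p = 0 := congrArg (fun f => f.1 ⟨p, hp⟩) hm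
  have hh' := congrArg (fun f => f.1 ⟨p, hp⟩) hh
  rw [RayRing.comb_apply] at hh'
  simp only [Subalgebra.coe_sub, Subalgebra.coe_mul, Subalgebra.coe_add, Pi.sub_apply,
    Pi.mul_apply, Pi.add_apply] at hh'
  have hDH : ∀ i, ((rayRing σ ε hUo hU).D i (mk H hH)).1 ⟨p, hp⟩ = pd i H p :=
    fun i => congrArg (fun f => f.1 ⟨p, hp⟩) (partialDeriv_mk hUo i _ hH)
  simp only [hDH] at hh'
  simp only [mk] at hh'
  -- The flat gauge `h - ξ H - 2 H m` vanishes; with `m = 0` and `ξ H = 0` this is `h = 0`.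
  rw [sum_mul_pd, hX hp, hinv c b' hab.1 hab.2 p hp, hm'] at hh'
  exact ⟨by simpa using hh', hm'⟩

theorem isKSVF_of_eqOn_rotField {c : ℝ} {b : Fin 3 → ℝ} (hb0 : a * b 0 = 0) (hb1 : a * b 1 = 0)
    {ξ : Coord → Coord} (hX : Set.EqOn ξ (rotField c b) U) :
    IsKSVF U (ksMetric H (pnd σ ε a)) (pnd σ ε a) ξ (fun _ => 0) (fun _ => 0) := by
  have hξ : ∀ i, ContDiffOn ℝ ∞ (fun p => ξ p i) U := fun i =>
    (contDiff_rotField c b i).contDiffOn.congr fun p hp => congrFun (hX hp) i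
  refine (isKSVF_iff hUo hU hξ hH contDiffOn_const contDiffOn_const).2 ?_
  have hcomb : (rayRing σ ε hUo hU).comb (fun k => mk _ (hξ k)) (mk H hH) = 0 := by
    refine SmoothRing.ext fun p => ?_
    have hDH : ∀ i, ((rayRing σ ε hUo hU).D i (mk H hH)).1 p = pd i H p :=
      fun i => congrArg (fun f => f.1 p) (partialDeriv_mk hUo i _ hH)
    rw [RayRing.comb_apply]
    simp only [Subalgebra.coe_mul, Subalgebra.coe_add, Pi.mul_apply, Pi.add_apply, hDH]
    simp only [mk]
    rw [sum_mul_pd, hX p.2, hinv c b hb0 hb1 p p.2]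
    rfl
  have hzero : (mk (fun _ => 0) contDiffOn_const : SmoothRing U) = 0 := rfl
  rw [hcomb, hzero, mul_zero, sub_zero, sub_zero]
  have hconst : ∀ (c : ℝ) (i : Fin 4),
      (rayRing σ ε hUo hU).D i (algebraMap ℝ (SmoothRing U) c) = 0 :=
    fun c i => Derivation.map_algebraMap _ _
  refine RayRing.flatKSVF_of_rotation _ (b := fun j => algebraMap ℝ _ (b j)) (fun i => ?_)
    (fun i j => hconst _ i) ?_ ?_ ?_ ?_ ?_
  · rw [show mk _ (hξ 0) = algebraMap ℝ (SmoothRing U) c from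
      SmoothRing.ext fun p => congrFun (hX p.2) 0]
    exact hconst c i
  · exact SmoothRing.ext fun p => hb0
  · exact SmoothRing.ext fun p => hb1
  · exact SmoothRing.ext fun p => congrFun (hX p.2) 1
  · exact SmoothRing.ext fun p => congrFun (hX p.2) 2
  · exact SmoothRing.ext fun p => congrFun (hX p.2) 3

end

end

end KerrSchild

namespace KerrSchild

noncomputable section

/-! ### Screw motions -/

/-- The rotation with unit axis `u` and angle `φ`. -/
def rodrigues (u : Fin 3 → ℝ) (φ : ℝ) : Matrix (Fin 3) (Fin 3) ℝ :=
  !![Real.cos φ + (1 - Real.cos φ) * (u 0 * u 0),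
      (1 - Real.cos φ) * (u 0 * u 1) - Real.sin φ * u 2,
      (1 - Real.cos φ) * (u 0 * u 2) + Real.sin φ * u 1;
    (1 - Real.cos φ) * (u 1 * u 0) + Real.sin φ * u 2,
      Real.cos φ + (1 - Real.cos φ) * (u 1 * u 1),
      (1 - Real.cos φ) * (u 1 * u 2) - Real.sin φ * u 0;
    (1 - Real.cos φ) * (u 2 * u 0) - Real.sin φ * u 1,
      (1 - Real.cos φ) * (u 2 * u 1) + Real.sin φ * u 0,
      Real.cos φ + (1 - Real.cos φ) * (u 2 * u 2)]

/-- A rotation with unit axis `u` and angle `φ`, combined with a time translation by `c`. -/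
def screw (c φ : ℝ) (u : Fin 3 → ℝ) : Coord → Coord := fun p =>
  Fin.cons (p 0 + c) (rodrigues u φ *ᵥ ![p 1, p 2, p 3])

section

variable (c φ : ℝ) (u : Fin 3 → ℝ) (p : Coord)

theorem screw_zero : screw c φ u p 0 = p 0 + c := rfl

theorem screw_one : screw c φ u p 1 = (Real.cos φ + (1 - Real.cos φ) * (u 0 * u 0)) * p 1
    + ((1 - Real.cos φ) * (u 0 * u 1) - Real.sin φ * u 2) * p 2
    + ((1 - Real.cos φ) * (u 0 * u 2) + Real.sin φ * u 1) * p 3 := by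
  change (rodrigues u φ *ᵥ ![p 1, p 2, p 3]) 0 = _
  simp [Matrix.mulVec, dotProduct, Fin.sum_univ_three, rodrigues]

theorem screw_two : screw c φ u p 2 = ((1 - Real.cos φ) * (u 1 * u 0) + Real.sin φ * u 2) * p 1
    + (Real.cos φ + (1 - Real.cos φ) * (u 1 * u 1)) * p 2
    + ((1 - Real.cos φ) * (u 1 * u 2) - Real.sin φ * u 0) * p 3 := by
  change (rodrigues u φ *ᵥ ![p 1, p 2, p 3]) 1 = _
  simp [Matrix.mulVec, dotProduct, Fin.sum_univ_three, rodrigues]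

theorem screw_three : screw c φ u p 3 = ((1 - Real.cos φ) * (u 2 * u 0) - Real.sin φ * u 1) * p 1
    + ((1 - Real.cos φ) * (u 2 * u 1) + Real.sin φ * u 0) * p 2
    + (Real.cos φ + (1 - Real.cos φ) * (u 2 * u 2)) * p 3 := by
  change (rodrigues u φ *ᵥ ![p 1, p 2, p 3]) 2 = _
  simp [Matrix.mulVec, dotProduct, Fin.sum_univ_three, rodrigues]

theorem screw_zero_zero : screw 0 0 u p = p := by
  ext i
  fin_cases i
  · exact add_zero (p 0)
  · simpa using screw_one 0 0 u p
  · simpa using screw_two 0 0 u p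
  · simpa using screw_three 0 0 u p

variable {u}

theorem screw_norm (hu : u 0 ^ 2 + u 1 ^ 2 + u 2 ^ 2 = 1) :
    screw c φ u p 1 ^ 2 + screw c φ u p 2 ^ 2 + screw c φ u p 3 ^ 2
      = p 1 ^ 2 + p 2 ^ 2 + p 3 ^ 2 := by
  have h := Real.sin_sq_add_cos_sq φ
  rw [screw_one, screw_two, screw_three]
  generalize Real.sin φ = S at *
  generalize Real.cos φ = C at *
  linear_combination (S ^ 2 * (p 1 ^ 2 + p 2 ^ 2 + p 3 ^ 2)
      + (1 - C) ^ 2 * (u 0 * p 1 + u 1 * p 2 + u 2 * p 3) ^ 2) * hu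
    + (p 1 ^ 2 + p 2 ^ 2 + p 3 ^ 2 - (u 0 * p 1 + u 1 * p 2 + u 2 * p 3) ^ 2) * h

/-- The factor `a` treats both cases at once: for `a ≠ 0` the axis is vertical and `z` is preserved,
for `a = 0` nothing is claimed. -/
theorem screw_three_of_axis {a : ℝ} (hu : u 0 ^ 2 + u 1 ^ 2 + u 2 ^ 2 = 1) (h0 : a * u 0 = 0)
    (h1 : a * u 1 = 0) : a * screw c φ u p 3 = a * p 3 := by
  rw [screw_three]
  linear_combination (((1 - Real.cos φ) * u 2) * p 1 + Real.sin φ * p 2) * h0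
    + (-Real.sin φ * p 1 + (1 - Real.cos φ) * u 2 * p 2) * h1
    + (1 - Real.cos φ) * p 3 * (a * hu - u 0 * h0 - u 1 * h1)

theorem hasDerivAt_screw (hu : u 0 ^ 2 + u 1 ^ 2 + u 2 ^ 2 = 1) (s : ℝ) :
    HasDerivAt (fun s => screw (s * c) (s * φ) u p)
      (rotField c (fun i => φ * u i) (screw (s * c) (s * φ) u p)) s := by
  have hs : HasDerivAt (fun s : ℝ => s * φ) φ s := by simpa using (hasDerivAt_id s).mul_const φ
  have hS := hs.sin
  have hC := hs.cos
  have hC' := hC.const_sub 1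
  refine hasDerivAt_pi.2 fun i => ?_
  fin_cases i
  · simpa [screw_zero, rotField] using ((hasDerivAt_id s).mul_const c).const_add (p 0)
  · change HasDerivAt (fun s => screw (s * c) (s * φ) u p 1)
      (rotField c (fun i => φ * u i) (screw (s * c) (s * φ) u p) 1) s
    simp only [screw_one]
    refine HasDerivAt.congr_deriv ((((hC.add (hC'.mul_const (u 0 * u 0))).mul_const (p 1)).add
      (((hC'.mul_const (u 0 * u 1)).sub (hS.mul_const (u 2))).mul_const (p 2))).add
      (((hC'.mul_const (u 0 * u 2)).add (hS.mul_const (u 1))).mul_const (p 3))) ?_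
    simp only [rotField, screw_one, screw_two, screw_three]
    simp
    generalize Real.sin (s * φ) = S
    generalize Real.cos (s * φ) = C
    linear_combination (φ * S * p 1) * hu
  · change HasDerivAt (fun s => screw (s * c) (s * φ) u p 2)
      (rotField c (fun i => φ * u i) (screw (s * c) (s * φ) u p) 2) s
    simp only [screw_two]
    refine HasDerivAt.congr_deriv (((((hC'.mul_const (u 1 * u 0)).add (hS.mul_const (u 2))).mul_const (p 1)).add
      ((hC.add (hC'.mul_const (u 1 * u 1))).mul_const (p 2))).add
      (((hC'.mul_const (u 1 * u 2)).sub (hS.mul_const (u 0))).mul_const (p 3))) ?_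
    simp only [rotField, screw_one, screw_two, screw_three]
    simp
    generalize Real.sin (s * φ) = S
    generalize Real.cos (s * φ) = C
    linear_combination (φ * S * p 2) * hu
  · change HasDerivAt (fun s => screw (s * c) (s * φ) u p 3)
      (rotField c (fun i => φ * u i) (screw (s * c) (s * φ) u p) 3) s
    simp only [screw_three]
    refine HasDerivAt.congr_deriv (((((hC'.mul_const (u 2 * u 0)).sub (hS.mul_const (u 1))).mul_const (p 1)).add
      (((hC'.mul_const (u 2 * u 1)).add (hS.mul_const (u 0))).mul_const (p 2))).add
      ((hC.add (hC'.mul_const (u 2 * u 2))).mul_const (p 3))) ?_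
    simp only [rotField, screw_one, screw_two, screw_three]
    simp
    generalize Real.sin (s * φ) = S
    generalize Real.cos (s * φ) = C
    linear_combination (φ * S * p 3) * hu

end

theorem radius_congr {a : ℝ} {p q : Coord}
    (h : q 1 ^ 2 + q 2 ^ 2 + q 3 ^ 2 = p 1 ^ 2 + p 2 ^ 2 + p 3 ^ 2) (h3 : a * q 3 = a * p 3) :
    radius a q = radius a p := by
  have h4 : 4 * a ^ 2 * q 3 ^ 2 = 4 * a ^ 2 * p 3 ^ 2 := by
    linear_combination 4 * (a * q 3 + a * p 3) * h3
  rw [radius, radius, h, h4]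

theorem exists_axis_angle {a : ℝ} {b : Fin 3 → ℝ} (h0 : a * b 0 = 0) (h1 : a * b 1 = 0) :
    ∃ (u : Fin 3 → ℝ) (φ : ℝ), u 0 ^ 2 + u 1 ^ 2 + u 2 ^ 2 = 1 ∧ a * u 0 = 0 ∧ a * u 1 = 0 ∧
      b = fun i => φ * u i := by
  by_cases hb : b 0 ^ 2 + b 1 ^ 2 + b 2 ^ 2 = 0
  -- Without rotation the axis is arbitrary; the vertical one is admissible for every `a`.
  · refine ⟨![0, 0, 1], 0, by simp, by simp, by simp, funext fun i => ?_⟩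
    have e0 : b 0 = 0 := by nlinarith [sq_nonneg (b 0), sq_nonneg (b 1), sq_nonneg (b 2)]
    have e1 : b 1 = 0 := by nlinarith [sq_nonneg (b 0), sq_nonneg (b 1), sq_nonneg (b 2)]
    have e2 : b 2 = 0 := by nlinarith [sq_nonneg (b 0), sq_nonneg (b 1), sq_nonneg (b 2)]
    fin_cases i <;> simp [e0, e1, e2]
  · have hpos : 0 < b 0 ^ 2 + b 1 ^ 2 + b 2 ^ 2 := lt_of_le_of_ne (by positivity) (Ne.symm hb)
    have hs := Real.sq_sqrt hpos.le
    have hs' := (Real.sqrt_pos.2 hpos).ne'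
    generalize √(b 0 ^ 2 + b 1 ^ 2 + b 2 ^ 2) = w at hs hs'
    refine ⟨fun i => b i / w, w, ?_, ?_, ?_, funext fun i => ?_⟩
    · field_simp; exact hs.symm
    · rw [mul_div_assoc', h0, zero_div]
    · rw [mul_div_assoc', h1, zero_div]
    · field_simp

/-- `H` is constant along the short piece of the screw orbit through `p` that lies in `U`, because
`radius` and `a * z` are; the derivative at time 0 is the claim. -/
theorem fderiv_rotField_eq_zero {a : ℝ} {U : Set Coord} (hUo : IsOpen U) {H : Coord → ℝ}
    (hH : ContDiffOn ℝ ∞ H U)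
    (hinv : ∀ p ∈ U, ∀ q ∈ U, radius a p = radius a q → a * p 3 = a * q 3 → H p = H q)
    (c : ℝ) (b : Fin 3 → ℝ) (h0 : a * b 0 = 0) (h1 : a * b 1 = 0) (p : Coord) (hp : p ∈ U) :
    fderiv ℝ H p (rotField c b p) = 0 := by
  obtain ⟨u, φ, hu, hu0, hu1, rfl⟩ := exists_axis_angle h0 h1
  have hd := hasDerivAt_screw c φ p hu 0
  have e : screw (0 * c) (0 * φ) u p = p := by simp [screw_zero_zero]
  have hcont : ∀ᶠ s in nhds (0 : ℝ), screw (s * c) (s * φ) u p ∈ U :=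
    hd.continuousAt.preimage_mem_nhds (by rw [e]; exact hUo.mem_nhds hp)
  have hconst : (fun s => H (screw (s * c) (s * φ) u p)) =ᶠ[nhds 0] fun _ => H p := by
    filter_upwards [hcont] with s hs
    have h3 := screw_three_of_axis (s * c) (s * φ) p hu hu0 hu1
    exact hinv _ hs _ hp (radius_congr (screw_norm _ _ p hu) h3) h3
  have hc := (SmoothRing.differentiableAt hUo hH hp).hasFDerivAt
  rw [e] at hd
  have := HasFDerivAt.comp_hasDerivAt_of_eq 0 hc hd e.symm
  exact this.unique ((hasDerivAt_const 0 (H p)).congr_of_eventuallyEq hconst)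

end

end KerrSchild

namespace KerrSchild

/-! ### Rotations -/

theorem exists_unit_orthogonal (u : Fin 3 → ℝ) :
    ∃ v : Fin 3 → ℝ, v 0 ^ 2 + v 1 ^ 2 + v 2 ^ 2 = 1 ∧ v 0 * u 0 + v 1 * u 1 + v 2 * u 2 = 0 := by
  by_cases h : u 0 ^ 2 + u 1 ^ 2 = 0
  · refine ⟨![1, 0, 0], by simp, ?_⟩
    have : u 0 = 0 := by nlinarith [sq_nonneg (u 0), sq_nonneg (u 1)]
    simp [this]
  · have hpos : 0 < u 0 ^ 2 + u 1 ^ 2 := lt_of_le_of_ne (by positivity) (Ne.symm h)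
    have hs := Real.sq_sqrt hpos.le
    have hs' := (Real.sqrt_pos.2 hpos).ne'
    generalize √(u 0 ^ 2 + u 1 ^ 2) = w at hs hs'
    refine ⟨![-u 1 / w, u 0 / w, 0], ?_, ?_⟩
    · simp; field_simp; linarith
    · simp; field_simp; ring

theorem exists_cos_sin {C S : ℝ} (h : C ^ 2 + S ^ 2 = 1) : ∃ φ : ℝ, C = Real.cos φ ∧ S = Real.sin φ := by
  have hn : ‖(⟨C, S⟩ : ℂ)‖ = 1 := by
    rw [Complex.norm_def, Complex.normSq_mk, ← sq, ← sq, h, Real.sqrt_one]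
  have h0 : (⟨C, S⟩ : ℂ) ≠ 0 := fun h => by simp [h] at hn
  exact ⟨Complex.arg ⟨C, S⟩, by rw [Complex.cos_arg h0, hn, div_one], by
    rw [Complex.sin_arg, hn, div_one]⟩

/-- Euler's theorem: `R - 1 = R (1 - Rᵀ)`, so in odd dimension `det (R - 1)` equals its own negative
and 1 is an eigenvalue. -/
theorem exists_fixed_unit {R : Matrix (Fin 3) (Fin 3) ℝ}
    (hR : R ∈ Matrix.specialOrthogonalGroup (Fin 3) ℝ) :
    ∃ u : Fin 3 → ℝ, u 0 ^ 2 + u 1 ^ 2 + u 2 ^ 2 = 1 ∧ R *ᵥ u = u := by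
  obtain ⟨hO, hd⟩ := Matrix.mem_specialOrthogonalGroup_iff.1 hR
  rw [Matrix.mem_orthogonalGroup_iff] at hO
  have hdet : (R - 1).det = 0 := by
    have h1 : R - 1 = R * (1 - Rᵀ) := by
      rw [mul_sub, mul_one]
      congr 1
      exact hO.symm
    have h2 : (R - 1).det = -(R - 1).det := by
      conv_lhs => rw [h1, Matrix.det_mul, hd, one_mul, ← Matrix.det_transpose]
      rw [Matrix.transpose_sub, Matrix.transpose_one, Matrix.transpose_transpose,
        ← neg_sub R 1, Matrix.det_neg, Fintype.card_fin]
      ring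
    linarith
  obtain ⟨v, hv, hRv⟩ := Matrix.exists_mulVec_eq_zero_iff.2 hdet
  rw [Matrix.sub_mulVec, Matrix.one_mulVec, sub_eq_zero] at hRv
  have hpos : 0 < v 0 ^ 2 + v 1 ^ 2 + v 2 ^ 2 := by
    refine lt_of_le_of_ne (by positivity) fun h => hv (funext fun i => ?_)
    fin_cases i <;> simp <;> nlinarith [sq_nonneg (v 0), sq_nonneg (v 1), sq_nonneg (v 2)]
  have hs := Real.sq_sqrt hpos.le
  have hs' := (Real.sqrt_pos.2 hpos).ne'
  generalize √(v 0 ^ 2 + v 1 ^ 2 + v 2 ^ 2) = w at hs hs'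
  refine ⟨w⁻¹ • v, ?_, by rw [Matrix.mulVec_smul, hRv]⟩
  simp
  field_simp
  linarith

theorem rodrigues_mem {u : Fin 3 → ℝ} (hu : u 0 ^ 2 + u 1 ^ 2 + u 2 ^ 2 = 1) (φ : ℝ) :
    rodrigues u φ ∈ Matrix.specialOrthogonalGroup (Fin 3) ℝ := by
  have h := Real.sin_sq_add_cos_sq φ
  rw [Matrix.mem_specialOrthogonalGroup_iff, Matrix.mem_orthogonalGroup_iff]
  unfold rodrigues
  generalize Real.sin φ = S at *
  generalize Real.cos φ = C at *
  constructor
  -- One polynomial identity covers all entries of `R * Rᵀ`, with `d` the entry of the identity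
  -- matrix.
  · have key (i j : Fin 3) (d x : ℝ) (e : x - d = (u 0 ^ 2 + u 1 ^ 2 + u 2 ^ 2 - 1) *
        (S ^ 2 * d + (1 - C) ^ 2 * (u i * u j)) + (S ^ 2 + C ^ 2 - 1) * (d - u i * u j)) :
        x = d := by
      rw [hu, h] at e
      linarith
    ext i j
    refine key i j _ _ ?_
    rw [Matrix.mul_apply, Fin.sum_univ_three]
    fin_cases i <;> fin_cases j <;> simp <;> ring
  · rw [Matrix.det_fin_three]
    simp
    linear_combination (C ^ 2 * (1 - C) + C * S ^ 2
      + (1 - C) * S ^ 2 * (u 0 ^ 2 + u 1 ^ 2 + u 2 ^ 2 + 1)) * hu + h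

/-- In the orthonormal basis `u, v, u × v` with `u` a fixed vector, `R` is a plane rotation by some
angle `φ`; changing back gives Rodrigues' formula. -/
theorem exists_rodrigues {R : Matrix (Fin 3) (Fin 3) ℝ}
    (hR : R ∈ Matrix.specialOrthogonalGroup (Fin 3) ℝ) :
    ∃ (u : Fin 3 → ℝ) (φ : ℝ), u 0 ^ 2 + u 1 ^ 2 + u 2 ^ 2 = 1 ∧ R = rodrigues u φ := by
  obtain ⟨u, hu, hRu⟩ := exists_fixed_unit hR
  obtain ⟨v, hv, hvu⟩ := exists_unit_orthogonal u
  obtain ⟨hO, hd⟩ := Matrix.mem_specialOrthogonalGroup_iff.1 hR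
  have hO' := (Matrix.mem_orthogonalGroup_iff (Fin 3) ℝ).1 hO
  have hO'' := mul_eq_one_comm.1 hO'
  let B : Matrix (Fin 3) (Fin 3) ℝ :=
    !![u 0, v 0, u 1 * v 2 - u 2 * v 1;
      u 1, v 1, u 2 * v 0 - u 0 * v 2;
      u 2, v 2, u 0 * v 1 - u 1 * v 0]
  have hB : Bᵀ * B = 1 := by
    ext i j
    rw [Matrix.mul_apply, Fin.sum_univ_three]
    fin_cases i <;> fin_cases j <;> simp [B]
    · linear_combination hu
    · linear_combination hvu
    · ring
    · linear_combination hvu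
    · linear_combination hv
    · ring
    · ring
    · ring
    · linear_combination (v 0 ^ 2 + v 1 ^ 2 + v 2 ^ 2) * hu + hv
        - (v 0 * u 0 + v 1 * u 1 + v 2 * u 2) * hvu
  have hB' : B * Bᵀ = 1 := mul_eq_one_comm.1 hB
  obtain ⟨M, hM⟩ : ∃ M, M = Bᵀ * R * B := ⟨_, rfl⟩
  have hMM : M * Mᵀ = 1 := by
    calc M * Mᵀ = Bᵀ * (R * ((B * Bᵀ) * Rᵀ)) * B := by
          rw [hM]; simp only [Matrix.transpose_mul, Matrix.transpose_transpose, mul_assoc]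
      _ = 1 := by rw [hB', one_mul]; erw [hO']; rw [mul_one, hB]
  have hMd : M.det = 1 := by
    rw [hM, Matrix.det_mul, Matrix.det_mul, hd, mul_one, ← Matrix.det_mul, hB, Matrix.det_one]
  have hRM : R = B * M * Bᵀ := by
    calc R = (B * Bᵀ) * R * (B * Bᵀ) := by rw [hB', one_mul, mul_one]
      _ = _ := by rw [hM]; simp only [mul_assoc]
  have hBe : B *ᵥ ![1, 0, 0] = u := by
    ext i
    fin_cases i <;> simp [B, Matrix.mulVec, dotProduct, Fin.sum_univ_three]
  have hMe : M *ᵥ ![1, 0, 0] = ![1, 0, 0] := by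
    rw [hM, ← Matrix.mulVec_mulVec, hBe, ← Matrix.mulVec_mulVec, hRu, ← hBe,
      Matrix.mulVec_mulVec, hB, Matrix.one_mulVec]
  have c0 := congrFun hMe 0
  have c1 := congrFun hMe 1
  have c2 := congrFun hMe 2
  simp [Matrix.mulVec, dotProduct, Fin.sum_univ_three] at c0 c1 c2
  have row (i j : Fin 3) := congrFun (congrFun hMM i) j
  simp only [Matrix.mul_apply, Fin.sum_univ_three, Matrix.transpose_apply] at row
  have r00 := row 0 0
  have r11 := row 1 1
  have r12 := row 1 2
  rw [Matrix.one_apply_eq] at r00 r11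
  rw [Matrix.one_apply_ne (by decide)] at r12
  rw [Matrix.det_fin_three] at hMd
  rw [c0] at r00 hMd
  rw [c1] at r11 r12 hMd
  rw [c2] at r12 hMd
  have e1 : M 0 1 = 0 := by nlinarith [sq_nonneg (M 0 1), sq_nonneg (M 0 2)]
  have e2 : M 0 2 = 0 := by nlinarith [sq_nonneg (M 0 1), sq_nonneg (M 0 2)]
  rw [e1, e2] at hMd
  -- The lower block is orthogonal of determinant 1, hence equal to its cofactor matrix.
  have e3 : M 2 2 = M 1 1 := by
    linear_combination M 1 1 * hMd - M 2 2 * r11 + M 1 2 * r12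
  have e4 : M 2 1 = -M 1 2 := by
    linear_combination -M 1 2 * hMd - M 2 1 * r11 + M 1 1 * r12
  obtain ⟨φ, hC, hS⟩ := exists_cos_sin (C := M 1 1) (S := -M 1 2) (by linear_combination r11)
  refine ⟨u, φ, hu, ?_⟩
  have hMeq : M = !![1, 0, 0; 0, Real.cos φ, -Real.sin φ; 0, Real.sin φ, Real.cos φ] := by
    rw [← hC, ← hS]
    ext i j
    fin_cases i <;> fin_cases j <;> simp [c0, c1, c2, e1, e2, e3, e4]
  have hBB (i j : Fin 3) := congrFun (congrFun hB' i) j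
  simp only [Matrix.mul_apply, Fin.sum_univ_three, Matrix.transpose_apply] at hBB
  rw [hRM, hMeq]
  ext i j
  have e := hBB i j
  rw [Matrix.mul_apply, Fin.sum_univ_three]
  simp only [Matrix.mul_apply, Fin.sum_univ_three, Matrix.transpose_apply]
  unfold rodrigues
  -- The entry `e` of `B * Bᵀ = 1` handles the cosine terms; the sine terms use `v × (u × v) = u`.
  fin_cases i <;> fin_cases j <;> simp [B] at e ⊢
  · linear_combination Real.cos φ * e
  · linear_combination Real.cos φ * e + Real.sin φ * (-u 2 * hv + v 2 * hvu)
  · linear_combination Real.cos φ * e + Real.sin φ * (u 1 * hv - v 1 * hvu)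
  · linear_combination Real.cos φ * e - Real.sin φ * (-u 2 * hv + v 2 * hvu)
  · linear_combination Real.cos φ * e
  · linear_combination Real.cos φ * e + Real.sin φ * (-u 0 * hv + v 0 * hvu)
  · linear_combination Real.cos φ * e - Real.sin φ * (u 1 * hv - v 1 * hvu)
  · linear_combination Real.cos φ * e - Real.sin φ * (-u 0 * hv + v 0 * hvu)
  · linear_combination Real.cos φ * e

end KerrSchild

namespace KerrSchild

noncomputable section

/-! ### The Lie algebras and the groups -/

theorem mem_axialAlgebra {X : Coord → Coord} :
    X ∈ axialAlgebra ↔ ∃ (c : ℝ) (b : Fin 3 → ℝ), b 0 = 0 ∧ b 1 = 0 ∧ X = rotField c b := by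
  have key (c w : ℝ) (b : Fin 3 → ℝ) (h0 : b 0 = 0) (h1 : b 1 = 0) (h2 : b 2 = w) :
      c • fieldT + w • rotXY = rotField c b := by
    ext p i
    fin_cases i <;> simp [fieldT, rotXY, rotField, h0, h1, h2]
  rw [axialAlgebra, Submodule.mem_span_pair]
  constructor
  · rintro ⟨c, w, rfl⟩
    exact ⟨c, ![0, 0, w], rfl, rfl, key c w _ rfl rfl rfl⟩
  · rintro ⟨c, b, h0, h1, rfl⟩
    exact ⟨c, b 2, key c _ b h0 h1 rfl⟩

theorem mem_sphericalAlgebra {X : Coord → Coord} :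
    X ∈ sphericalAlgebra ↔ ∃ (c : ℝ) (b : Fin 3 → ℝ), X = rotField c b := by
  have key (c : ℝ) (b : Fin 3 → ℝ) :
      c • fieldT + (b 2 • rotXY + (-b 1 • rotXZ + b 0 • rotYZ)) = rotField c b := by
    ext p i
    fin_cases i <;> simp [fieldT, rotXY, rotXZ, rotYZ, rotField] <;> ring
  simp only [sphericalAlgebra, Submodule.mem_span_insert, Submodule.mem_span_singleton]
  constructor
  · rintro ⟨c, _, ⟨w, _, ⟨v, _, ⟨u, rfl⟩, rfl⟩, rfl⟩, rfl⟩
    refine ⟨c, ![u, -v, w], ?_⟩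
    rw [← key]
    simp
  · rintro ⟨c, b, rfl⟩
    exact ⟨c, _, ⟨b 2, _, ⟨-b 1, _, ⟨b 0, rfl⟩, rfl⟩, rfl⟩, (key c b).symm⟩

theorem mem_axialGroup {Φ : Coord → Coord} :
    Φ ∈ axialGroup ↔ ∃ (c φ : ℝ) (u : Fin 3 → ℝ), u 0 ^ 2 + u 1 ^ 2 + u 2 ^ 2 = 1 ∧
      u 0 = 0 ∧ u 1 = 0 ∧ Φ = screw c φ u := by
  have key (c φ θ : ℝ) (u : Fin 3 → ℝ) (h0 : u 0 = 0) (h1 : u 1 = 0) (h2 : u 2 * u 2 = 1)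
      (hC : Real.cos θ = Real.cos φ) (hS : Real.sin θ = Real.sin φ * u 2) :
      (fun p : Coord => (![p 0 + c, Real.cos θ * p 1 - Real.sin θ * p 2,
        Real.sin θ * p 1 + Real.cos θ * p 2, p 3] : Coord)) = screw c φ u := by
    funext p i
    fin_cases i
    · rfl
    · simp [screw_one, h0, h1, hC, hS]; ring
    · simp [screw_two, h0, h1, hC, hS]
    · simp [screw_three, h0, h1, h2]
  constructor
  · rintro ⟨c, θ, rfl⟩
    exact ⟨c, θ, ![0, 0, 1], by simp, rfl, rfl, key c θ θ _ rfl rfl (by simp) rfl (by simp)⟩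
  · rintro ⟨c, φ, u, hu, h0, h1, rfl⟩
    have h2 : u 2 * u 2 = 1 := by rw [h0, h1] at hu; linarith
    -- A downward axis reverses the sense of rotation, so the angle is `-φ`.
    rcases mul_self_eq_one_iff.1 h2 with h | h
    · exact ⟨c, φ, (key c φ φ u h0 h1 h2 rfl (by simp [h])).symm⟩
    · exact ⟨c, -φ, (key c φ (-φ) u h0 h1 h2 (Real.cos_neg φ) (by simp [h])).symm⟩

theorem mem_sphericalGroup {Φ : Coord → Coord} :
    Φ ∈ sphericalGroup ↔ ∃ (c φ : ℝ) (u : Fin 3 → ℝ), u 0 ^ 2 + u 1 ^ 2 + u 2 ^ 2 = 1 ∧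
      Φ = screw c φ u := by
  constructor
  · rintro ⟨c, R, hR, rfl⟩
    obtain ⟨u, φ, hu, rfl⟩ := exists_rodrigues hR
    exact ⟨c, φ, u, hu, rfl⟩
  · rintro ⟨c, φ, u, hu, rfl⟩
    exact ⟨c, rodrigues u φ, rodrigues_mem hu φ, rfl⟩

/-! ### Integral curves -/

theorem lipschitzWith_rotField (c : ℝ) (b : Fin 3 → ℝ) : ∃ K, LipschitzWith K (rotField c b) := by
  let A : Coord →ₗ[ℝ] Coord :=
    { toFun := rotField 0 b
      map_add' := fun p q => by ext i; fin_cases i <;> simp [rotField] <;> ring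
      map_smul' := fun k p => by ext i; fin_cases i <;> simp [rotField] <;> ring }
  refine ⟨‖A.toContinuousLinearMap‖₊, LipschitzWith.of_dist_le_mul fun p q => ?_⟩
  have e : rotField c b p - rotField c b q = A.toContinuousLinearMap (p - q) := by
    change _ = rotField 0 b (p - q)
    ext i
    fin_cases i <;> simp [rotField] <;> ring
  rw [dist_eq_norm, dist_eq_norm, e]
  exact A.toContinuousLinearMap.le_opNorm _

/-- Screw orbits are integral curves of the field, which is affine and hence globally Lipschitz, so
uniqueness for ODEs applies. -/
theorem eq_screw_of_integralCurve {c φ : ℝ} {u : Fin 3 → ℝ}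
    (hu : u 0 ^ 2 + u 1 ^ 2 + u 2 ^ 2 = 1) {γ : ℝ → Coord}
    (hγ : ∀ s ∈ Set.Icc (0 : ℝ) 1,
      HasDerivWithinAt γ (rotField c (fun i => φ * u i) (γ s)) (Set.Icc (0 : ℝ) 1) s) :
    γ 1 = screw c φ u (γ 0) := by
  obtain ⟨K, hK⟩ := lipschitzWith_rotField c (fun i => φ * u i)
  have hd := hasDerivAt_screw c φ (γ 0) hu
  have := ODE_solution_unique (v := fun _ => rotField c (fun i => φ * u i)) (fun _ => hK)
    (fun s hs => (hγ s hs).continuousWithinAt)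
    (fun s hs => (hγ s (Set.Ico_subset_Icc_self hs)).mono_of_mem_nhdsWithin
      (Icc_mem_nhdsGE_of_mem hs))
    (fun s _ => (hd s).continuousAt.continuousWithinAt)
    (fun s _ => (hd s).hasDerivWithinAt)
    (by simp [screw_zero_zero]) (Set.right_mem_Icc.2 zero_le_one)
  simpa using this

/-! ### Solution of the Kerr-Schild problem -/

/-- Common form of both cases: the conditions `a * b 0 = 0 = a * b 1` select the vertical axis if `a
≠ 0` and are void if `a = 0`. -/
theorem ksSolution {σ ε : ℤˣ} {a : ℝ} {U : Set Coord} (hUo : IsOpen U) (hUc : IsPreconnected U)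
    (hU : U ⊆ domain a) {H : Coord → ℝ} (hH : ContDiffOn ℝ ∞ H U)
    (hinv : ∀ p ∈ U, ∀ q ∈ U, radius a p = radius a q → a * p 3 = a * q 3 → H p = H q)
    {L : Submodule ℝ (Coord → Coord)} {G : Set (Coord → Coord)}
    (hL : ∀ X, X ∈ L ↔ ∃ (c : ℝ) (b : Fin 3 → ℝ), a * b 0 = 0 ∧ a * b 1 = 0 ∧ X = rotField c b)
    (hG : ∀ Φ, Φ ∈ G ↔ ∃ (c φ : ℝ) (u : Fin 3 → ℝ), u 0 ^ 2 + u 1 ^ 2 + u 2 ^ 2 = 1 ∧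
      a * u 0 = 0 ∧ a * u 1 = 0 ∧ Φ = screw c φ u) :
    KSSolution U (ksMetric H (pnd σ ε a)) (pnd σ ε a) L G := by
  have hinv' := fderiv_rotField_eq_zero hUo hH hinv
  refine ⟨fun ξ h m hK => (exists_rotField_of_isKSVF hUo hU hH hinv' hUc hK).2, fun ξ => ?_,
    fun V Ψ hV hΨ => ?_, fun hmaps Φ hΦ => ?_⟩
  · constructor
    · rintro ⟨h, m, hK⟩
      obtain ⟨c, b, h0, h1, hX⟩ := (exists_rotField_of_isKSVF hUo hU hH hinv' hUc hK).1
      exact ⟨_, (hL _).2 ⟨c, b, h0, h1, rfl⟩, hX⟩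
    · rintro ⟨X, hX, hξ⟩
      obtain ⟨c, b, h0, h1, rfl⟩ := (hL X).1 hX
      exact ⟨_, _, isKSVF_of_eqOn_rotField hUo hU hH hinv' h0 h1 hξ⟩
  · obtain ⟨ξ, h, m, hK, hγ⟩ := hΨ
    obtain ⟨c, b, h0, h1, hX⟩ := (exists_rotField_of_isKSVF hUo hU hH hinv' hUc hK).1
    obtain ⟨u, φ, hu, hu0, hu1, rfl⟩ := exists_axis_angle h0 h1
    refine ⟨_, (hG _).2 ⟨c, φ, u, hu, hu0, hu1, rfl⟩, fun p hp => ?_⟩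
    obtain ⟨γ, rfl, hγ1, hγ'⟩ := hγ p hp
    rw [← hγ1]
    refine eq_screw_of_integralCurve hu fun s hs => ?_
    rw [← hX (hγ' s hs).1]
    exact (hγ' s hs).2
  · obtain ⟨c, φ, u, hu, hu0, hu1, rfl⟩ := (hG Φ).1 hΦ
    refine ⟨rotField c (fun i => φ * u i), _, _, isKSVF_of_eqOn_rotField hUo hU hH hinv'
      (b := fun i => φ * u i) (by linear_combination φ * hu0) (by linear_combination φ * hu1)
      (Set.eqOn_refl _ _), fun p hp => ⟨fun s => screw (s * c) (s * φ) u p, ?_, ?_, fun s _ => ?_⟩⟩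
    · simp [screw_zero_zero]
    · simp
    -- The whole one-parameter family joining the identity to `Φ` lies in `G`, so invariance of `U`
    -- under all of `G` keeps the orbit inside `U`.
    · exact ⟨hmaps _ ((hG _).2 ⟨s * c, s * φ, u, hu, hu0, hu1, rfl⟩) hp,
        (hasDerivAt_screw c φ p hu s).hasDerivWithinAt⟩

/-! ### The cases `a ≠ 0` and `a = 0`, and the Kerr-Newman function -/

section

variable {σ ε : ℤˣ} {a : ℝ} {U : Set Coord} {H : Coord → ℝ}

theorem ksSolution_axial (ha : a ≠ 0) (hUo : IsOpen U) (hUc : IsPreconnected U)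
    (hU : U ⊆ domain a) (hH : ContDiffOn ℝ ∞ H U) {F : ℝ → ℝ → ℝ}
    (hF : ∀ p ∈ U, H p = F (branch ε a p) (p 3 / branch ε a p)) :
    KSSolution U (ksMetric H (pnd σ ε a)) (pnd σ ε a) axialAlgebra axialGroup := by
  refine ksSolution hUo hUc hU hH (fun p hp q hq hr hz => ?_) (fun X => ?_) fun Φ => ?_
  · rw [hF p hp, hF q hq, branch, branch, hr, mul_left_cancel₀ ha hz]
  · simp only [mem_axialAlgebra, mul_eq_zero, ha, false_or]
  · simp only [mem_axialGroup, mul_eq_zero, ha, false_or]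

theorem ksSolution_spherical (ha : a = 0) (hUo : IsOpen U) (hUc : IsPreconnected U)
    (hU : U ⊆ domain a) (hH : ContDiffOn ℝ ∞ H U) {F : ℝ → ℝ}
    (hF : ∀ p ∈ U, H p = F (branch ε a p)) :
    KSSolution U (ksMetric H (pnd σ ε a)) (pnd σ ε a) sphericalAlgebra sphericalGroup := by
  refine ksSolution hUo hUc hU hH (fun p hp q hq hr _ => ?_) (fun X => ?_) fun Φ => ?_
  · rw [hF p hp, hF q hq, branch, branch, hr]
  · simp only [mem_sphericalAlgebra, ha, zero_mul, true_and]
  · simp only [mem_sphericalGroup, ha, zero_mul, true_and]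

theorem contDiffOn_knH (ε : ℤˣ) (M Q a : ℝ) : ContDiffOn ℝ ∞ (knH ε M Q a) (domain a) := by
  have hr := contDiffOn_branch ε a
  have hz := (contDiff_coord 3).contDiffOn (s := domain a)
  refine ContDiffOn.div ((contDiffOn_const.mul hr).sub contDiffOn_const)
    ((hr.pow 2).add (contDiffOn_const.mul
      ((hz.div hr fun p hp => branch_ne_zero hp).pow 2))) fun p hp => ?_
  have := branch_ne_zero (ε := ε) hp
  positivity

theorem ksMetric_zero (l : Coord → Fin 4 → ℝ) : ksMetric (fun _ => 0) l = fun _ => eta := by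
  funext p
  simp [ksMetric]

end

end

end KerrSchild

theorem mainTheorem5 (a : ℝ) (σ ε : ℤˣ) (U : Set KerrSchild.Coord) (hUo : IsOpen U)
    (hUc : IsPreconnected U) (hU : U ⊆ KerrSchild.domain a) :
    -- Kerr-Newman metrics
    (∀ M Q : ℝ,
      (a ≠ 0 → KerrSchild.KSSolution U
        (KerrSchild.ksMetric (KerrSchild.knH ε M Q a) (KerrSchild.pnd σ ε a))
        (KerrSchild.pnd σ ε a) KerrSchild.axialAlgebra KerrSchild.axialGroup) ∧
      (a = 0 → KerrSchild.KSSolution U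
        (KerrSchild.ksMetric (KerrSchild.knH ε M Q a) (KerrSchild.pnd σ ε a))
        (KerrSchild.pnd σ ε a) KerrSchild.sphericalAlgebra KerrSchild.sphericalGroup)) ∧
    -- Kerr-Schild metrics with H = H(r, z/r) for a ≠ 0, and H = H(r) for a = 0
    (a ≠ 0 → ∀ (H : KerrSchild.Coord → ℝ) (F : ℝ → ℝ → ℝ), ContDiffOn ℝ ∞ H U →
      (∀ p ∈ U, H p = F (KerrSchild.branch ε a p) (p 3 / KerrSchild.branch ε a p)) →
      KerrSchild.KSSolution U (KerrSchild.ksMetric H (KerrSchild.pnd σ ε a))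
        (KerrSchild.pnd σ ε a) KerrSchild.axialAlgebra KerrSchild.axialGroup) ∧
    (a = 0 → ∀ (H : KerrSchild.Coord → ℝ) (F : ℝ → ℝ), ContDiffOn ℝ ∞ H U →
      (∀ p ∈ U, H p = F (KerrSchild.branch ε a p)) →
      KerrSchild.KSSolution U (KerrSchild.ksMetric H (KerrSchild.pnd σ ε a))
        (KerrSchild.pnd σ ε a) KerrSchild.sphericalAlgebra KerrSchild.sphericalGroup) ∧
    -- flat spacetime
    (a ≠ 0 → KerrSchild.KSSolution U (fun _ => KerrSchild.eta)
      (KerrSchild.pnd σ ε a) KerrSchild.axialAlgebra KerrSchild.axialGroup) ∧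
    (a = 0 → KerrSchild.KSSolution U (fun _ => KerrSchild.eta)
      (KerrSchild.pnd σ ε a) KerrSchild.sphericalAlgebra KerrSchild.sphericalGroup) := by
  refine ⟨fun M Q => ⟨fun ha => ?_, fun ha => ?_⟩, fun ha H F hH hF => ?_, fun ha H F hH hF => ?_,
    fun ha => ?_, fun ha => ?_⟩
  · exact KerrSchild.ksSolution_axial ha hUo hUc hU ((KerrSchild.contDiffOn_knH ε M Q a).mono hU)
      (F := fun r w => (2 * M * r - Q ^ 2) / (r ^ 2 + a ^ 2 * w ^ 2)) fun _ _ => rfl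
  · refine KerrSchild.ksSolution_spherical ha hUo hUc hU
      ((KerrSchild.contDiffOn_knH ε M Q a).mono hU)
      (F := fun r => (2 * M * r - Q ^ 2) / r ^ 2) fun p _ => ?_
    simp [KerrSchild.knH, ha]
  · exact KerrSchild.ksSolution_axial ha hUo hUc hU hH hF
  · exact KerrSchild.ksSolution_spherical ha hUo hUc hU hH hF
  · rw [← KerrSchild.ksMetric_zero (KerrSchild.pnd σ ε a)]
    exact KerrSchild.ksSolution_axial ha hUo hUc hU contDiffOn_const (F := fun _ _ => 0)
      fun _ _ => rfl
  · rw [← KerrSchild.ksMetric_zero (KerrSchild.pnd σ ε a)]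
    exact KerrSchild.ksSolution_spherical ha hUo hUc hU contDiffOn_const (F := fun _ => 0)
      fun _ _ => rfl
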